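/- Let $1\le k\le n$, let $\mathcal P_n$ be the space of complex polynomials in $z$ of degree at most $n$, and let $N=k(n+1-k)$. A matrix $g=\begin{pmatrix}a&b\\c&d\end{pmatrix}\in\mathrm{SL}_2(\mathbb C)$ acts on $\mathcal P_n$ by $p(z)\mapsto (cz+d)^n\,p\!\left(\frac{az+b}{cz+d}\right)$, and on $\mathcal P_N$ by the same formula with $N$ in place of $n$. Two subspaces of $\mathcal P_n$ are projectively equivalent if some $g\in\mathrm{SL}_2(\mathbb C)$ maps one onto the other. A $k$-dimensional monomial subspace of $\mathcal P_n$ is one of the form $\operatorname{span}\{z^{\nu_1},\dots,z^{\nu_k}\}$ with $0\le\nu_1<\dots<\nu_k\le n$. Let $U\subset\mathcal P_n$ be a $k$-dimensional subspace, let $p_1,\dots,p_k$ be any basis of $U$, and let $Q=W(U)=\det\big(p_i^{(j)}\big)_{1\le i\le k,\,0\le j\le k-1}\in\mathcal P_N$ be the Wronskian of $U$ (changing the basis multiplies $Q$ by a non-zero scalar). The roots of $Q$ on $\mathbb{CP}^1=\mathbb C\cup\{\infty\}$ are its finite roots together with $\infty$ if $\deg Q<N$. Let $\operatorname{Stab}(Q)\subset\mathrm{PSL}_2(\mathbb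 C)$ be the group of transformations that map the line $\mathbb C\,Q\subset\mathcal P_N$ to itself. Put $$H[Q]=N(N-1)\Big[QQ''-\tfrac{N-1}{N}(Q')^2\Big],$$ $$T[Q]=-N^2(N-1)\Big[Q^2Q'''-3\tfrac{N-2}{N}QQ'Q''+2\tfrac{(N-1)(N-2)}{N^2}(Q')^3\Big],$$ and, if $H[Q]\ne0$, $J^2[Q]=T[Q]^2/H[Q]^3\in\mathbb C(z)$. Then the following are equivalent: (a) $U$ is projectively equivalent to a $k$-dimensional monomial subspace of $\mathcal P_n$; (b) $Q$ has exactly one or exactly two distinct roots on $\mathbb{CP}^1$; (c) $H[Q]=0$, or $H[Q]\neq 0$ and $J^2[Q]$ is constant; (d) $\operatorname{Stab}(Q)$ is infinite; (e) $\operatorname{Stab}(Q)$ is one of the following infinite groups: the 2-dimensional group of all transformations in $\mathrm{PSL}_2(\mathbb C)$ fixing some point $r\in\mathbb{CP}^1$; or, for some pair of distinct points $r,s\in\mathbb{CP}^1$, the 1-dimensional group of all transformations fixing both $r$ and $s$, or the 1-dimensional group of all transformations mapping $\{r,s\}$ to itself. -/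

import Mathlib

open Polynomial
open scoped LinearAlgebra.Projectivization Pointwise

namespace PolySubspace

/-- The group `PSL₂(ℂ)` of fractional linear transformations. -/
abbrev PSL2 : Type := Matrix.ProjectiveSpecialLinearGroup (Fin 2) ℂ

/-- The complex projective line; `[x : y]` corresponds to `z = x / y` in the extended plane. -/
abbrev CP1 : Type := ℙ ℂ (Fin 2 → ℂ)

/-- The point of the projective line given by a finite complex number. -/
noncomputable def finPt (z : ℂ) : CP1 := Projectivization.mk ℂ ![z, 1] (by simp)

/-- The point at infinity of the projective line. -/
noncomputable def inftyPt : CP1 := Projectivization.mk ℂ ![1, 0] (by simp)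

/-- `G_k P_n`: the `k`-dimensional subspaces of the space `P_n` of complex polynomials of
degree at most `n`. -/
def grassmannian (k n : ℕ) : Set (Submodule ℂ ℂ[X]) :=
  {U | U ≤ degreeLE ℂ (n : WithBot ℕ) ∧ Module.finrank ℂ U = k}

/-- The projective action of the matrix `g = (a, b; c, d)` on `P_n`,
`p(z) ↦ (c z + d) ^ n * p ((a z + b) / (c z + d))`, written out on the coefficients
`p_0, ..., p_n` of `p` as `∑ p_i (a z + b) ^ i (c z + d) ^ (n - i)`. -/
noncomputable def act (n : ℕ) (g : Matrix.SpecialLinearGroup (Fin 2) ℂ) : ℂ[X] →ₗ[ℂ] ℂ[X] :=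
  ∑ i ∈ Finset.range (n + 1),
    (lcoeff ℂ i).smulRight ((C (g 0 0) * X + C (g 0 1)) ^ i * (C (g 1 0) * X + C (g 1 1)) ^ (n - i))

/-- Projective equivalence of subspaces of `P_n`. -/
def ProjEquiv (n : ℕ) (U V : Submodule ℂ ℂ[X]) : Prop :=
  ∃ g : Matrix.SpecialLinearGroup (Fin 2) ℂ, V = U.map (act n g)

/-- A subspace `span {z ^ ν_1, ..., z ^ ν_k}` with `0 ≤ ν_1 < ... < ν_k ≤ n`. -/
def IsMonomialSubspace (k n : ℕ) (V : Submodule ℂ ℂ[X]) : Prop :=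
  ∃ ν : Fin k → ℕ, StrictMono ν ∧ (∀ i, ν i ≤ n) ∧
    V = Submodule.span ℂ (Set.range fun i => (X : ℂ[X]) ^ ν i)

/-- The Wronskian determinant of `p_1, ..., p_k`. -/
noncomputable def wronskian {k : ℕ} (p : Fin k → ℂ[X]) : ℂ[X] :=
  (Matrix.of fun i j : Fin k => derivative^[(j : ℕ)] (p i)).det

/-- The set of distinct roots on the projective line of `Q`, regarded as an element of `P_N`:
its finite roots, together with infinity when `deg Q < N`. -/
def projRoots (N : ℕ) (Q : ℂ[X]) : Set CP1 :=
  {x | (∃ z : ℂ, Q.IsRoot z ∧ x = finPt z) ∨ (Q.degree < (N : WithBot ℕ) ∧ x = inftyPt)}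

/-- The transformations in `PSL₂(ℂ)` that map `Q`, an element of `P_N` taken up to scalar
multiples, to itself. -/
def projStab (N : ℕ) (Q : ℂ[X]) : Set PSL2 :=
  (fun g : Matrix.SpecialLinearGroup (Fin 2) ℂ => (g : PSL2)) ''
    {g | (Submodule.span ℂ {Q}).map (act N g) = Submodule.span ℂ {Q}}

/-- The Hessian covariant
`H[Q] = N (N - 1) (Q Q'' - ((N - 1) / N) Q' ^ 2)` of `Q` in `P_N`. -/
noncomputable def covH (N : ℕ) (Q : ℂ[X]) : ℂ[X] :=
  C ((N : ℂ) * (N - 1)) *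
    (Q * derivative^[2] Q - C (((N : ℂ) - 1) / N) * derivative Q ^ 2)

/-- The covariant
`T[Q] = - N² (N - 1) (Q² Q''' - 3 ((N - 2) / N) Q Q' Q'' + 2 ((N - 1) (N - 2) / N²) Q' ^ 3)`. -/
noncomputable def covT (N : ℕ) (Q : ℂ[X]) : ℂ[X] :=
  C (-((N : ℂ) ^ 2 * (N - 1))) *
    (Q ^ 2 * derivative^[3] Q
      - C (3 * (((N : ℂ) - 2) / N)) * (Q * derivative Q * derivative^[2] Q)
      + C (2 * (((N : ℂ) - 1) * (N - 2) / (N : ℂ) ^ 2)) * derivative Q ^ 3)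

/-- The rational covariant `J² = T² / H³` (meaningful when `H ≠ 0`). -/
noncomputable def covJ2 (N : ℕ) (Q : ℂ[X]) : RatFunc ℂ :=
  algebraMap ℂ[X] (RatFunc ℂ) (covT N Q ^ 2) / algebraMap ℂ[X] (RatFunc ℂ) (covH N Q ^ 3)

/-- The possible types of an infinite symmetry group, as a subset of `PSL₂(ℂ)`: the
(two-dimensional) group of all transformations that fix some point `r` of the projective line; or,
for some pair of distinct points `r`, `s`, the (one-dimensional) group of all transformations that
fix both points, or the (one-dimensional) group of all those that map `{r, s}` to itself. -/
def IsInfiniteType (S : Set PSL2) : Prop :=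
  (∃ r : CP1, S = MulAction.stabilizer PSL2 r) ∨
  (∃ r s : CP1, r ≠ s ∧
    (S = (MulAction.stabilizer PSL2 r ⊓ MulAction.stabilizer PSL2 s : Subgroup PSL2) ∨
     S = MulAction.stabilizer PSL2 ({r, s} : Set CP1)))

end PolySubspace

namespace PolySubspace

open scoped Matrix

/-! All five conditions say that `Q` can be moved by `SL₂` to a monomial `c z ^ m`.

For (a): the Wronskian is nonzero and intertwines the two actions (`wronskian_act`), and a monomial
family has a monomial Wronskian. Conversely (`isMonomialSubspace_of_wronskian`), choose a basis of
`U` with distinct orders `ν i` at `0` and distinct degrees `d i`. The lowest and highest terms of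
its Wronskian sit in degrees `∑ ν i - M` and `∑ d i - M`, where `M = 0 + 1 + ... + (k - 1)`. If the
Wronskian is a monomial, the two sums agree, so `ν i = d i` for each `i` and the basis consists of
monomials.

For (b): `SL₂` is transitive on pairs of distinct points, so at most two roots can be moved to `0`
and `∞`. There is at least one root because `N > 0`.

For (c): if `Q = c u ^ a v ^ b` with `u`, `v` linear, then `H` and `T` are constant multiples of `(Q
/ uv) ^ 2` and `(Q / uv) ^ 3`. Conversely, if `H` or `T` vanishes, its lowest term at a root shows
that the multiplicity is at least `N / 2`. If `J²` is a nonzero constant, then `H = g ^ 2` and `T =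
t g ^ 3`, and the Jacobian formula for `T` becomes a first-order equation `N Q g' - (N - 2) Q' g = κ
g ^ 2`; comparing orders at finite points and at infinity leaves at most two roots.

For (d) and (e): the stabilizer permutes the roots and only the identity fixes three points, so an
infinite stabilizer allows at most two roots. The stabilizer of a monomial is computed directly. -/

/-- The group `SL₂(ℂ)`. -/
abbrev SL2 : Type := Matrix.SpecialLinearGroup (Fin 2) ℂ

theorem det_expand (g : SL2) : g 0 0 * g 1 1 - g 0 1 * g 1 0 = 1 := by
  have := g.det_coe
  rwa [Matrix.det_fin_two] at this

/-! ### Binary forms and the projective action -/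

/-- The homogeneous form of degree `n` attached to `p`, evaluated at `v = (x, y)`. -/
noncomputable def formEval (n : ℕ) (p : ℂ[X]) (v : Fin 2 → ℂ) : ℂ :=
  ∑ i ∈ Finset.range (n + 1), p.coeff i * (v 0 ^ i * v 1 ^ (n - i))

theorem formEval_smul (n : ℕ) (p : ℂ[X]) (t : ℂ) (v : Fin 2 → ℂ) :
    formEval n p (t • v) = t ^ n * formEval n p v := by
  rw [formEval, formEval, Finset.mul_sum]
  refine Finset.sum_congr rfl fun i hi => ?_
  have hi' : i + (n - i) = n := by have := Finset.mem_range.mp hi; omega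
  have : t ^ n = t ^ i * t ^ (n - i) := by rw [← pow_add, hi']
  simp only [Pi.smul_apply, smul_eq_mul, mul_pow, this]
  ring

theorem formEval_finite {n : ℕ} {p : ℂ[X]} (hp : p.natDegree ≤ n) (z : ℂ) :
    formEval n p ![z, 1] = p.eval z := by
  rw [eval_eq_sum_range' (Nat.lt_succ_of_le hp)]
  simp [formEval]

theorem formEval_infty (n : ℕ) (p : ℂ[X]) : formEval n p ![1, 0] = p.coeff n := by
  rw [formEval, Finset.sum_eq_single n]
  · simp
  · intro i hi hin
    have : n - i ≠ 0 := by have := Finset.mem_range.mp hi; omega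
    simp [this]
  · simp

theorem act_apply (n : ℕ) (g : SL2) (p : ℂ[X]) :
    act n g p = ∑ i ∈ Finset.range (n + 1), p.coeff i •
      ((C (g 0 0) * X + C (g 0 1)) ^ i * (C (g 1 0) * X + C (g 1 1)) ^ (n - i)) := by
  simp [act, LinearMap.sum_apply]

theorem act_X_pow {n i : ℕ} (hi : i ≤ n) (g : SL2) :
    act n g (X ^ i) =
      (C (g 0 0) * X + C (g 0 1)) ^ i * (C (g 1 0) * X + C (g 1 1)) ^ (n - i) := by
  rw [act_apply, Finset.sum_eq_single i]
  · simp
  · intro j _ hj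
    simp [coeff_X_pow, hj]
  · intro h
    exact absurd (Finset.mem_range.mpr (Nat.lt_succ_of_le hi)) h

theorem eval_act (n : ℕ) (g : SL2) (p : ℂ[X]) (z : ℂ) :
    (act n g p).eval z = formEval n p (g.1 *ᵥ ![z, 1]) := by
  simp [act_apply, eval_finsetSum, formEval, Matrix.mulVec, dotProduct]

theorem natDegree_linear_factors_le (n i : ℕ) (hi : i ≤ n) (a b c d : ℂ) :
    ((C a * X + C b) ^ i * (C c * X + C d) ^ (n - i)).natDegree ≤ n := by
  refine natDegree_mul_le.trans ?_
  have h1 := natDegree_pow_le_of_le (p := C a * X + C b) i (natDegree_linear_le)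
  have h2 := natDegree_pow_le_of_le (p := C c * X + C d) (n - i) (natDegree_linear_le)
  omega

theorem natDegree_act_le (n : ℕ) (g : SL2) (p : ℂ[X]) : (act n g p).natDegree ≤ n := by
  rw [act_apply]
  refine natDegree_sum_le_of_forall_le _ _ fun i hi => ?_
  exact (natDegree_smul_le _ _).trans
    (natDegree_linear_factors_le n i (Nat.lt_succ_iff.mp (Finset.mem_range.mp hi)) _ _ _ _)

theorem coeff_act_top (n : ℕ) (g : SL2) (p : ℂ[X]) :
    (act n g p).coeff n = formEval n p (g.1 *ᵥ ![1, 0]) := by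
  rw [act_apply, finsetSum_coeff, formEval]
  refine Finset.sum_congr rfl fun i hi => ?_
  have hi' : i + (n - i) = n := by have := Finset.mem_range.mp hi; omega
  have h1 : ∀ (a b : ℂ) (m : ℕ), ((C a * X + C b) ^ m).coeff m = a ^ m := by
    intro a b m
    have := coeff_pow_of_natDegree_le (p := C a * X + C b) (m := m) (natDegree_linear_le)
    rw [mul_one] at this
    rw [this]
    simp
  have h2 : ∀ (a b : ℂ) (m : ℕ), ((C a * X + C b) ^ m).natDegree ≤ m := by
    intro a b m
    simpa using natDegree_pow_le_of_le (p := C a * X + C b) m (natDegree_linear_le)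
  have h3 := coeff_mul_add_eq_of_natDegree_le (h2 (g 0 0) (g 0 1) i) (h2 (g 1 0) (g 1 1) (n - i))
  rw [hi'] at h3
  rw [coeff_smul, h3, h1, h1]
  simp [Matrix.mulVec, dotProduct]

theorem eq_smul_finite {v : Fin 2 → ℂ} (h : v 1 ≠ 0) : v = v 1 • ![v 0 / v 1, 1] := by
  ext i
  fin_cases i
  · simp [mul_div_cancel₀ _ h]
  · simp

theorem eq_smul_infty {v : Fin 2 → ℂ} (h : v 1 = 0) : v = v 0 • ![1, 0] := by
  ext i
  fin_cases i
  · simp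
  · simp [h]

/-- Both sides are homogeneous of degree `n` in `v`, so the points `(z, 1)` and `(1, 0)` suffice.
The action thus becomes precomposition with a linear map, from which its formal properties follow.
-/
theorem formEval_act (n : ℕ) (g : SL2) (p : ℂ[X]) (v : Fin 2 → ℂ) :
    formEval n (act n g p) v = formEval n p (g.1 *ᵥ v) := by
  by_cases h : v 1 = 0
  · rw [eq_smul_infty h, Matrix.mulVec_smul, formEval_smul, formEval_smul, formEval_infty,
      coeff_act_top]
  · rw [eq_smul_finite h, Matrix.mulVec_smul, formEval_smul, formEval_smul,
      formEval_finite (natDegree_act_le n g p), eval_act]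

theorem ext_formEval {n : ℕ} {p q : ℂ[X]} (hp : p.natDegree ≤ n) (hq : q.natDegree ≤ n)
    (h : ∀ v, formEval n p v = formEval n q v) : p = q :=
  Polynomial.funext fun z => by rw [← formEval_finite hp, ← formEval_finite hq, h]

/-- Precomposition reverses the order of the factors: this is a right action. -/
theorem act_act (n : ℕ) (g h : SL2) (p : ℂ[X]) :
    act n g (act n h p) = act n (h * g) p := by
  refine ext_formEval (natDegree_act_le _ _ _) (natDegree_act_le _ _ _) fun v => ?_
  rw [formEval_act, formEval_act, formEval_act, Matrix.mulVec_mulVec,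
    Matrix.SpecialLinearGroup.coe_mul]

theorem act_one {n : ℕ} {p : ℂ[X]} (hp : p.natDegree ≤ n) : act n 1 p = p := by
  refine ext_formEval (natDegree_act_le _ _ _) hp fun v => ?_
  simp [formEval_act]

theorem act_inv_act {n : ℕ} {p : ℂ[X]} (hp : p.natDegree ≤ n) (g : SL2) :
    act n g⁻¹ (act n g p) = p := by
  rw [act_act, mul_inv_cancel, act_one hp]

theorem act_act_inv {n : ℕ} {p : ℂ[X]} (hp : p.natDegree ≤ n) (g : SL2) :
    act n g (act n g⁻¹ p) = p := by
  rw [act_act, inv_mul_cancel, act_one hp]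

theorem act_ne_zero {n : ℕ} {p : ℂ[X]} (hp : p.natDegree ≤ n) (hp0 : p ≠ 0) (g : SL2) :
    act n g p ≠ 0 := fun h => hp0 (by rw [← act_inv_act hp g, h, map_zero])

theorem formEval_mul {m n : ℕ} {p q : ℂ[X]} (hp : p.natDegree ≤ m) (hq : q.natDegree ≤ n)
    (v : Fin 2 → ℂ) : formEval (m + n) (p * q) v = formEval m p v * formEval n q v := by
  have hpq : (p * q).natDegree ≤ m + n := natDegree_mul_le_of_le hp hq
  by_cases h : v 1 = 0
  · rw [eq_smul_infty h]
    simp only [formEval_smul, formEval_infty, coeff_mul_add_eq_of_natDegree_le hp hq]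
    ring
  · rw [eq_smul_finite h]
    simp only [formEval_smul, formEval_finite hp, formEval_finite hq, formEval_finite hpq, eval_mul]
    ring

theorem act_mul {m n : ℕ} {p q : ℂ[X]} (hp : p.natDegree ≤ m) (hq : q.natDegree ≤ n)
    (g : SL2) : act (m + n) g (p * q) = act m g p * act n g q := by
  refine ext_formEval (natDegree_act_le _ _ _)
    (natDegree_mul_le_of_le (natDegree_act_le _ _ _) (natDegree_act_le _ _ _)) fun v => ?_
  rw [formEval_act, formEval_mul hp hq,
    formEval_mul (natDegree_act_le _ _ _) (natDegree_act_le _ _ _), formEval_act, formEval_act]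

theorem act_prod {ι : Type*} (s : Finset ι) (m : ι → ℕ) (f : ι → ℂ[X])
    (hf : ∀ i ∈ s, (f i).natDegree ≤ m i) (g : SL2) :
    act (∑ i ∈ s, m i) g (∏ i ∈ s, f i) = ∏ i ∈ s, act (m i) g (f i) := by
  classical
  induction s using Finset.induction_on with
  | empty => simp [act_apply]
  | insert a s ha ih =>
    rw [Finset.sum_insert ha, Finset.prod_insert ha, Finset.prod_insert ha,
      act_mul (hf a (Finset.mem_insert_self _ _)), ih fun i hi => hf i (Finset.mem_insert_of_mem hi)]
    exact (natDegree_prod_le _ _).trans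
      (Finset.sum_le_sum fun i hi => hf i (Finset.mem_insert_of_mem hi))

/-- Raising the weight by `m` multiplies the transform by the `m`-th power of the denominator. -/
theorem act_add {n : ℕ} {p : ℂ[X]} (hp : p.natDegree ≤ n) (m : ℕ) (g : SL2) :
    act (m + n) g p = (C (g 1 0) * X + C (g 1 1)) ^ m * act n g p := by
  have h := act_mul (m := m) (p := 1) (by simp) hp g
  rw [one_mul] at h
  rw [h]
  have h1 := act_X_pow (Nat.zero_le m) g
  rw [pow_zero, pow_zero, one_mul, Nat.sub_zero] at h1
  rw [h1]

theorem den_ne_zero (g : SL2) : C (g 1 0) * X + C (g 1 1) ≠ (0 : ℂ[X]) := by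
  intro h
  have h0 := congrArg (fun q => coeff q 0) h
  have h1 := congrArg (fun q => coeff q 1) h
  simp at h0 h1
  have := det_expand g
  simp [h0, h1] at this

/-! ### Equivariance of the Wronskian -/

/-- The chain rule: `(az + b) / (cz + d)` has derivative `(cz + d) ^ (-2)` since the determinant is
`1`, so differentiation lowers the weight by one, up to a multiple of the transform itself. -/
theorem derivative_act {n : ℕ} {p : ℂ[X]} (hp : p.natDegree ≤ n + 1) (g : SL2) :
    (C (g 1 0) * X + C (g 1 1)) * derivative (act (n + 1) g p) =
      C (((n : ℂ) + 1) * g 1 0) * act (n + 1) g p + act n g (derivative p) := by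
  rw [p.as_sum_range' _ (Nat.lt_succ_of_le hp)]
  simp only [map_sum, Finset.mul_sum, ← Finset.sum_add_distrib]
  refine Finset.sum_congr rfl fun i hi => ?_
  have hi' : i ≤ n + 1 := Nat.lt_succ_iff.mp (Finset.mem_range.mp hi)
  rw [← C_mul_X_pow_eq_monomial, ← smul_eq_C_mul (p.coeff i), map_smul, derivative_smul, derivative_smul,
    map_smul, act_X_pow hi', mul_smul_comm, mul_smul_comm, ← smul_add]
  congr 1
  have hdet : (C (g 0 0) * C (g 1 1) - C (g 0 1) * C (g 1 0) : ℂ[X]) = 1 := by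
    rw [← C_mul, ← C_mul, ← C_sub, det_expand, C_1]
  rcases i with _ | j
  · simp only [pow_zero, one_mul, derivative_one, map_zero, add_zero, Nat.sub_zero]
    rw [derivative_pow_succ]
    simp
    ring
  · obtain ⟨l, rfl⟩ : ∃ l, n = j + l := ⟨n - j, by omega⟩
    rw [derivative_X_pow_succ, ← smul_eq_C_mul ((j : ℂ) + 1), map_smul, act_X_pow (by omega)]
    rw [show j + l + 1 - (j + 1) = l by omega, show j + l - j = l by omega]
    rcases l with _ | l
    · simp only [pow_zero, mul_one, add_zero]
      rw [derivative_pow_succ, smul_eq_C_mul]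
      simp
      linear_combination ((j : ℂ[X]) + 1) * (C (g 0 0) * X + C (g 0 1)) ^ j * hdet
    · rw [derivative_mul, derivative_pow_succ, derivative_pow_succ, smul_eq_C_mul]
      simp
      linear_combination ((j : ℂ[X]) + 1) * (C (g 0 0) * X + C (g 0 1)) ^ j *
        (C (g 1 0) * X + C (g 1 1)) ^ (l + 1) * hdet

/-- Iterated derivatives of a transform: they are, up to powers of the denominator, a unitriangular
combination of transforms of iterated derivatives. -/
theorem exists_iterate_derivative_act (n : ℕ) (g : SL2) (j : ℕ) (hj : j ≤ n) :
    ∃ a : ℕ → ℂ, a j = 1 ∧ ∀ p : ℂ[X], p.natDegree ≤ n →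
      (C (g 1 0) * X + C (g 1 1)) ^ j * derivative^[j] (act n g p) =
        ∑ i ∈ Finset.range (j + 1), C (a i) * act (n - i) g (derivative^[i] p) := by
  induction j with
  | zero => exact ⟨fun _ => 1, rfl, fun p _ => by simp⟩
  | succ j ih =>
    obtain ⟨a, ha, h⟩ := ih (by omega)
    -- The coefficient recursion: `n - i` is the weight in `derivative_act`, `-j` comes from
    -- differentiating the power of the denominator, and `a (i - 1)` from the term with one more
    -- derivative.
    refine ⟨fun i => (if i < j + 1 then a i * (((n - i : ℕ) : ℂ) - j) * g 1 0 else 0) +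
      (if i = 0 then 0 else a (i - 1)), by simp [ha], fun p hp => ?_⟩
    have h1 : (C (g 1 0) * X + C (g 1 1)) ^ (j + 1) * derivative^[j + 1] (act n g p) =
        (C (g 1 0) * X + C (g 1 1)) *
          derivative ((C (g 1 0) * X + C (g 1 1)) ^ j * derivative^[j] (act n g p)) -
        C (j * g 1 0) * ((C (g 1 0) * X + C (g 1 1)) ^ j * derivative^[j] (act n g p)) := by
      rw [Function.iterate_succ_apply', derivative_mul]
      rcases j with _ | j
      · simp
      · rw [derivative_pow_succ]
        simp
        ring
    rw [h1, h p hp, derivative_sum, Finset.mul_sum, Finset.mul_sum, ← Finset.sum_sub_distrib]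
    have h2 : ∀ i ∈ Finset.range (j + 1),
        (C (g 1 0) * X + C (g 1 1)) *
          derivative (C (a i) * act (n - i) g (derivative^[i] p)) -
        C (j * g 1 0) * (C (a i) * act (n - i) g (derivative^[i] p)) =
        C (a i * (((n - i : ℕ) : ℂ) - j) * g 1 0) * act (n - i) g (derivative^[i] p) +
          C (a i) * act (n - (i + 1)) g (derivative^[i + 1] p) := by
      intro i hi
      have hi' : i < j + 1 := Finset.mem_range.mp hi
      obtain ⟨l, hl⟩ : ∃ l, n - i = l + 1 := ⟨n - i - 1, by omega⟩
      have hd : (derivative^[i] p).natDegree ≤ l + 1 :=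
        (natDegree_iterate_derivative p i).trans (by omega)
      have := derivative_act hd g
      rw [derivative_C_mul, mul_left_comm, hl, this, show n - (i + 1) = l by omega,
        Function.iterate_succ_apply']
      simp only [C_mul, C_sub, C_add, Nat.cast_add, Nat.cast_one]
      ring
    rw [Finset.sum_congr rfl h2, Finset.sum_add_distrib]
    simp only [C_add, add_mul, Finset.sum_add_distrib]
    refine congrArg₂ (· + ·) ?_ ?_
    · rw [Finset.sum_range_succ _ (j + 1)]
      simp only [lt_irrefl, if_false, C_0, zero_mul, add_zero]
      refine Finset.sum_congr rfl fun i hi => ?_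
      rw [if_pos (Finset.mem_range.mp hi)]
    · rw [Finset.sum_range_succ' _ (j + 1)]
      simp

theorem natDegree_wronskian_le_sum {k n : ℕ} {p : Fin k → ℂ[X]} (hp : ∀ i, (p i).natDegree ≤ n) :
    (wronskian p).natDegree ≤ ∑ j : Fin k, (n - j) := by
  rw [wronskian, Matrix.det_apply]
  refine natDegree_sum_le_of_forall_le _ _ fun σ _ => (natDegree_smul_le _ _).trans ?_
  refine (natDegree_prod_le _ _).trans (Finset.sum_le_sum fun j _ => ?_)
  exact (natDegree_iterate_derivative _ _).trans (Nat.sub_le_sub_right (hp _) _)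

/-- Give column `j` the factor `(cz + d) ^ j`. The columns are then a unitriangular combination of
the transformed columns, and transforming is multiplicative on the products in the determinant. -/
theorem pow_mul_wronskian_act {k n : ℕ} (hkn : k ≤ n + 1) {p : Fin k → ℂ[X]}
    (hp : ∀ i, (p i).natDegree ≤ n) (g : SL2) :
    (C (g 1 0) * X + C (g 1 1)) ^ (∑ j : Fin k, (j : ℕ)) * wronskian (fun i => act n g (p i)) =
      act (∑ j : Fin k, (n - j)) g (wronskian p) := by
  have hj : ∀ j : Fin k, (j : ℕ) ≤ n := fun j => by omega
  choose a ha h using fun j : Fin k => exists_iterate_derivative_act n g j (hj j)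
  let A : Matrix (Fin k) (Fin k) ℂ[X] := Matrix.of fun m j => if m ≤ j then C (a j m) else 0
  let B : Matrix (Fin k) (Fin k) ℂ[X] :=
    Matrix.of fun i m => act (n - m) g (derivative^[(m : ℕ)] (p i))
  have hA : A.det = 1 := by
    rw [Matrix.det_of_isUpperTriangular]
    · simp [A, ha]
    · intro i j hij
      simp only [id_eq] at hij
      simp [A, not_le.mpr hij]
  have hB : B.det = act (∑ j : Fin k, (n - j)) g (wronskian p) := by
    rw [wronskian, Matrix.det_apply, Matrix.det_apply, map_sum]
    refine Finset.sum_congr rfl fun σ _ => ?_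
    rw [Units.smul_def, Units.smul_def, map_zsmul,
      act_prod _ (fun j : Fin k => n - (j : ℕ)) _ (fun j _ => ?_)]
    · rfl
    · exact (natDegree_iterate_derivative _ _).trans (Nat.sub_le_sub_right (hp _) _)
  rw [← hB, ← mul_one B.det, ← hA, ← Matrix.det_mul, wronskian, ← Finset.prod_pow_eq_pow_sum,
    ← Matrix.det_mul_row]
  congr 1
  ext1 i j
  simp only [Matrix.of_apply, Matrix.mul_apply, A, B]
  rw [h j (p i) (hp i)]
  rw [← Fin.sum_univ_eq_sum_range
    (fun m => C (a j m) * act (n - m) g (derivative^[m] (p i))) (j + 1)]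
  simp only [mul_ite, mul_zero]
  rw [← Finset.sum_filter]
  refine Finset.sum_bij (fun m _ => Fin.castLE (by omega : (j : ℕ) + 1 ≤ k) m) ?_ ?_ ?_ ?_
  · intro m _
    simp only [Finset.mem_filter, Finset.mem_univ, true_and, Fin.le_def, Fin.val_castLE]
    omega
  · intro m _ m' _ hm
    simpa using hm
  · intro m hm
    have hm' : m ≤ j := by simpa using hm
    exact ⟨⟨m, Nat.lt_succ_of_le hm'⟩, Finset.mem_univ _, rfl⟩
  · intro m _
    rw [mul_comm, Fin.val_castLE]

theorem sum_sub_eq {k n : ℕ} (hk : k ≤ n) :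
    ∑ j : Fin k, (n - (j : ℕ)) = ∑ j : Fin k, (j : ℕ) + k * (n + 1 - k) := by
  rw [Fin.sum_univ_eq_sum_range (fun j => n - j), Fin.sum_univ_eq_sum_range (fun j => j)]
  induction k with
  | zero => simp
  | succ k ih =>
    rw [Finset.sum_range_succ, Finset.sum_range_succ, ih (by omega)]
    obtain ⟨l, rfl⟩ : ∃ l, n = k + 1 + l := ⟨n - (k + 1), by omega⟩
    rw [show k + 1 + l + 1 - k = l + 2 by omega, show k + 1 + l - k = l + 1 by omega,
      show k + 1 + l + 1 - (k + 1) = l + 1 by omega]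
    ring

/-- The column bound gives only `M + N`. For an inversion with denominator `z`, the transform of the
Wronskian is divisible by `z ^ M`, so the quotient has degree at most `N`; transforming back turns
`z ^ M` into `1`. -/
theorem natDegree_wronskian_le {k n : ℕ} (hk : k ≤ n) {p : Fin k → ℂ[X]}
    (hp : ∀ i, (p i).natDegree ≤ n) : (wronskian p).natDegree ≤ k * (n + 1 - k) := by
  let S : SL2 := ⟨!![0, 1; -1, 0], by simp⟩
  have h := pow_mul_wronskian_act (by omega) hp S⁻¹
  have hW := natDegree_wronskian_le_sum hp
  rw [sum_sub_eq hk] at h hW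
  set M := ∑ j : Fin k, (j : ℕ)
  have hS : C (S⁻¹ 1 0) * X + C (S⁻¹ 1 1) = (X : ℂ[X]) := by
    have hinv : S⁻¹.1 = !![0, -1; 1, 0] := by
      rw [Matrix.SpecialLinearGroup.SL2_inv_expl]
      simp [S]
      rfl
    rw [hinv]
    simp
  rw [hS] at h
  set R := wronskian fun i => act n S⁻¹ (p i)
  by_cases hR : R = 0
  · rw [← act_act_inv hW S, ← h, hR]
    simp
  have hRd : R.natDegree ≤ k * (n + 1 - k) := by
    have h1 := natDegree_act_le (M + k * (n + 1 - k)) S⁻¹ (wronskian p)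
    rw [← h, natDegree_mul (pow_ne_zero _ X_ne_zero) hR, natDegree_X_pow] at h1
    omega
  rw [← act_act_inv hW S, ← h, act_mul (by simp) hRd, act_X_pow le_rfl]
  have : C (S 0 0) * X + C (S 0 1) = (1 : ℂ[X]) := by simp [S]
  rw [this, Nat.sub_self, pow_zero, one_pow, one_mul, one_mul]
  exact natDegree_act_le _ _ _

/-- The Wronskian intertwines the projective actions. -/
theorem wronskian_act {k n : ℕ} (hk : k ≤ n) {p : Fin k → ℂ[X]}
    (hp : ∀ i, (p i).natDegree ≤ n) (g : SL2) :
    wronskian (fun i => act n g (p i)) = act (k * (n + 1 - k)) g (wronskian p) := by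
  have h := pow_mul_wronskian_act (by omega) hp g
  rw [sum_sub_eq hk, act_add (natDegree_wronskian_le hk hp)] at h
  exact mul_left_cancel₀ (pow_ne_zero _ (den_ne_zero g)) h

/-! ### Orders, degrees and monomial Wronskians -/

/-- A linear change of the functions multiplies the Wronskian by the determinant. -/
theorem wronskian_linear_comb {k : ℕ} (A : Matrix (Fin k) (Fin k) ℂ) (p : Fin k → ℂ[X]) :
    wronskian (fun i => ∑ l, A i l • p l) = C A.det * wronskian p := by
  rw [wronskian, wronskian, show C A.det = (A.map C).det from RingHom.map_det C A,
    ← Matrix.det_mul]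
  congr 1
  ext1 i j
  simp [Matrix.mul_apply, iterate_derivative_sum, smul_eq_C_mul, iterate_derivative_C_mul]

/-- The Wronskian of a family in the span of `p` is a multiple of the Wronskian of `p`. -/
theorem exists_wronskian_eq {k : ℕ} {p q : Fin k → ℂ[X]}
    (h : ∀ i, q i ∈ Submodule.span ℂ (Set.range p)) :
    ∃ c : ℂ, wronskian q = C c * wronskian p := by
  choose A hA using fun i => (Submodule.mem_span_range_iff_exists_fun ℂ).mp (h i)
  refine ⟨(Matrix.of A).det, ?_⟩
  rw [← wronskian_linear_comb]
  congr 1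
  ext1 i
  exact (hA i).symm

/-- Falling factorials are monic of degree `j`, so this is a Vandermonde determinant in the `ν i`.
-/
theorem det_descFactorial_ne_zero {k : ℕ} {ν : Fin k → ℕ} (hν : Function.Injective ν) :
    (Matrix.of fun i j : Fin k => ((ν i).descFactorial j : ℂ)).det ≠ 0 := by
  have h := Matrix.det_eval_matrixOfPolynomials_eq_det_vandermonde (fun i => (ν i : ℂ))
    (fun j : Fin k => descPochhammer ℂ j) (fun j => descPochhammer_natDegree ℂ j)
    (fun j => monic_descPochhammer ℂ j)
  simp only [descPochhammer_eval_eq_descFactorial] at h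
  rw [← h, Matrix.det_vandermonde_ne_zero_iff]
  exact fun i j hij => hν (Nat.cast_injective hij)

theorem coeff_prod_sum_of_natDegree_le {ι : Type*} (s : Finset ι) (m : ι → ℕ) (f : ι → ℂ[X])
    (hf : ∀ i, (f i).natDegree ≤ m i) :
    (∏ i ∈ s, f i).coeff (∑ i ∈ s, m i) = ∏ i ∈ s, (f i).coeff (m i) := by
  classical
  induction s using Finset.induction_on with
  | empty => simp
  | insert a s ha ih =>
    rw [Finset.sum_insert ha, Finset.prod_insert ha, Finset.prod_insert ha,
      coeff_mul_add_eq_of_natDegree_le (hf a)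
        ((natDegree_prod_le _ _).trans (Finset.sum_le_sum fun i _ => hf i)), ih]

theorem coeff_prod_sum_of_X_pow_dvd {ι : Type*} (s : Finset ι) (m : ι → ℕ) (f : ι → ℂ[X])
    (hf : ∀ i, X ^ m i ∣ f i) :
    (∏ i ∈ s, f i).coeff (∑ i ∈ s, m i) = ∏ i ∈ s, (f i).coeff (m i) := by
  choose r hr using hf
  have h1 : ∀ i, (f i).coeff (m i) = (r i).eval 0 := by
    intro i
    have := coeff_X_pow_mul (r i) (m i) 0
    rw [zero_add] at this
    rw [hr i, this, coeff_zero_eq_eval_zero]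
  have h2 : ∏ i ∈ s, f i = X ^ (∑ i ∈ s, m i) * ∏ i ∈ s, r i := by
    rw [← Finset.prod_pow_eq_pow_sum, ← Finset.prod_mul_distrib]
    exact Finset.prod_congr rfl fun i _ => hr i
  have h3 := coeff_X_pow_mul (∏ i ∈ s, r i) (∑ i ∈ s, m i) 0
  rw [zero_add] at h3
  rw [h2, h3, coeff_zero_eq_eval_zero, eval_prod]
  exact Finset.prod_congr rfl fun i _ => (h1 i).symm

theorem coeff_X_pow_mul_iterate_derivative (p : ℂ[X]) (j m : ℕ) :
    (X ^ j * derivative^[j] p).coeff m = (m.descFactorial j : ℂ) * p.coeff m := by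
  rw [coeff_X_pow_mul']
  split_ifs with h
  · rw [coeff_iterate_derivative, Nat.sub_add_cancel h, nsmul_eq_mul]
  · rw [Nat.descFactorial_of_lt (not_le.mp h), Nat.cast_zero, zero_mul]

theorem X_pow_mul_wronskian {k : ℕ} (p : Fin k → ℂ[X]) :
    X ^ (∑ j : Fin k, (j : ℕ)) * wronskian p =
      (Matrix.of fun i j : Fin k => X ^ (j : ℕ) * derivative^[(j : ℕ)] (p i)).det := by
  rw [wronskian, ← Finset.prod_pow_eq_pow_sum, ← Matrix.det_mul_row]
  rfl

/-- The operators `z ^ j (d/dz) ^ j` are diagonal on monomials, so only the extreme coefficient of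
each entry contributes, and the coefficient is a product of these with a Vandermonde determinant.
The two alternatives serve the highest and the lowest term. -/
theorem coeff_X_pow_mul_wronskian_ne_zero {k : ℕ} {p : Fin k → ℂ[X]} {ν : Fin k → ℕ}
    (hν : Function.Injective ν) (h0 : ∀ i, (p i).coeff (ν i) ≠ 0)
    (h : (∀ i, (p i).natDegree ≤ ν i) ∨ (∀ i, X ^ ν i ∣ p i)) :
    (X ^ (∑ j : Fin k, (j : ℕ)) * wronskian p).coeff (∑ i, ν i) ≠ 0 := by
  have key : (X ^ (∑ j : Fin k, (j : ℕ)) * wronskian p).coeff (∑ i, ν i) =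
      (Matrix.of fun i j : Fin k => (p i).coeff (ν i) * ((ν i).descFactorial j : ℂ)).det := by
    rw [X_pow_mul_wronskian, Matrix.det_apply, Matrix.det_apply, finsetSum_coeff]
    refine Finset.sum_congr rfl fun σ _ => ?_
    rw [Units.smul_def, Units.smul_def, coeff_smul]
    congr 1
    rw [← Equiv.sum_comp σ]
    have h3 : (∏ i, (Matrix.of fun i j : Fin k => X ^ (j : ℕ) * derivative^[(j : ℕ)] (p i))
        (σ i) i).coeff (∑ i, ν (σ i)) =
        ∏ i : Fin k, (X ^ (i : ℕ) * derivative^[(i : ℕ)] (p (σ i))).coeff (ν (σ i)) := by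
      rcases h with h | h
      · refine coeff_prod_sum_of_natDegree_le _ _ _ fun i => ?_
        rw [natDegree_le_iff_coeff_eq_zero]
        intro m hm
        rw [Matrix.of_apply, coeff_X_pow_mul_iterate_derivative,
          coeff_eq_zero_of_natDegree_lt ((h _).trans_lt hm), mul_zero]
      · refine coeff_prod_sum_of_X_pow_dvd _ _ _ fun i => ?_
        rw [X_pow_dvd_iff]
        intro m hm
        rw [Matrix.of_apply, coeff_X_pow_mul_iterate_derivative, X_pow_dvd_iff.mp (h _) m hm,
          mul_zero]
    rw [h3]
    refine Finset.prod_congr rfl fun i _ => ?_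
    rw [coeff_X_pow_mul_iterate_derivative, Matrix.of_apply, mul_comm]
  rw [key]
  have := Matrix.det_mul_column (fun i => (p i).coeff (ν i))
    (Matrix.of fun i j : Fin k => ((ν i).descFactorial j : ℂ))
  simp only [Matrix.of_apply] at this
  rw [this]
  exact mul_ne_zero (Finset.prod_ne_zero_iff.mpr fun i _ => h0 i) (det_descFactorial_ne_zero hν)

/-- A subspace of dimension `k` contains elements of `k` different orders of vanishing at `0`. -/
theorem exists_strictMono_orders {k n : ℕ} {p : Fin k → ℂ[X]} (hp : LinearIndependent ℂ p)
    (hpn : ∀ i, (p i).natDegree ≤ n) :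
    ∃ ν : Fin k → ℕ, StrictMono ν ∧ (∀ i, ν i ≤ n) ∧ ∀ i, ∃ q ∈ Submodule.span ℂ (Set.range p),
      q ≠ 0 ∧ q.natTrailingDegree = ν i := by
  classical
  set U := Submodule.span ℂ (Set.range p)
  have hU : U ≤ degreeLE ℂ n := by
    rw [Submodule.span_le]
    rintro _ ⟨i, rfl⟩
    exact mem_degreeLE.mpr (natDegree_le_iff_degree_le.mp (hpn i))
  let S := (Finset.range (n + 1)).filter fun m => ∃ q ∈ U, q ≠ 0 ∧ q.natTrailingDegree = m
  have hS : k ≤ S.card := by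
    -- Reading off the coefficients indexed by `S` is injective, because a nonzero element of `U`
    -- has its trailing coefficient there.
    let f : U →ₗ[ℂ] (S → ℂ) := LinearMap.pi fun s => (lcoeff ℂ (s : ℕ)).comp U.subtype
    have hf : Function.Injective f := by
      rw [← LinearMap.ker_eq_bot, LinearMap.ker_eq_bot']
      rintro ⟨q, hq⟩ hfq
      by_contra hne
      have hq0 : q ≠ 0 := fun h => hne (Subtype.ext h)
      have hqn : q.natDegree ≤ n := natDegree_le_iff_degree_le.mpr (mem_degreeLE.mp (hU hq))
      have hmem : q.natTrailingDegree ∈ S := Finset.mem_filter.mpr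
        ⟨Finset.mem_range.mpr (Nat.lt_succ_of_le ((natTrailingDegree_le_natDegree q).trans hqn)),
          q, hq, hq0, rfl⟩
      have := congrFun hfq ⟨_, hmem⟩
      exact hq0 (trailingCoeff_eq_zero.mp this)
    have h1 := LinearMap.finrank_le_finrank_of_injective hf
    rwa [finrank_span_eq_card hp, Fintype.card_fin, Module.finrank_fintype_fun_eq_card,
      Fintype.card_coe] at h1
  obtain ⟨T, hTS, hT⟩ := Finset.exists_subset_card_eq hS
  refine ⟨T.orderEmbOfFin hT, (T.orderEmbOfFin hT).strictMono, fun i => ?_, fun i => ?_⟩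
  · have := (Finset.mem_filter.mp (hTS (T.orderEmbOfFin_mem hT i))).1
    exact Nat.lt_succ_iff.mp (Finset.mem_range.mp this)
  · exact (Finset.mem_filter.mp (hTS (T.orderEmbOfFin_mem hT i))).2

theorem X_pow_natTrailingDegree_dvd (q : ℂ[X]) : X ^ q.natTrailingDegree ∣ q :=
  X_pow_dvd_iff.mpr fun _ hm => coeff_eq_zero_of_lt_natTrailingDegree hm

theorem wronskian_ne_zero {k n : ℕ} {p : Fin k → ℂ[X]} (hp : LinearIndependent ℂ p)
    (hpn : ∀ i, (p i).natDegree ≤ n) : wronskian p ≠ 0 := by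
  obtain ⟨ν, hν, -, h⟩ := exists_strictMono_orders hp hpn
  choose q hqU hq0 hq using h
  obtain ⟨c, hc⟩ := exists_wronskian_eq hqU
  have := coeff_X_pow_mul_wronskian_ne_zero (p := q) hν.injective
    (fun i => by rw [← hq i]; exact fun h => hq0 i (trailingCoeff_eq_zero.mp h))
    (Or.inr fun i => by rw [← hq i]; exact X_pow_natTrailingDegree_dvd _)
  intro h0
  rw [hc, h0] at this
  simp at this

/-- A subspace whose Wronskian is a monomial is a monomial subspace. -/
theorem isMonomialSubspace_of_wronskian {k n : ℕ} {p : Fin k → ℂ[X]}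
    (hp : LinearIndependent ℂ p) (hpn : ∀ i, (p i).natDegree ≤ n) {c : ℂ} {m : ℕ}
    (hW : wronskian p = C c * X ^ m) :
    IsMonomialSubspace k n (Submodule.span ℂ (Set.range p)) := by
  classical
  obtain ⟨ν, hν, hνn, h⟩ := exists_strictMono_orders hp hpn
  set U := Submodule.span ℂ (Set.range p) with hU
  -- Taking the least degree for each order forces distinct degrees: if two agreed, cancelling the
  -- leading term of the element of lower order would keep its order and lower its degree.
  have hmin : ∀ i, ∃ q ∈ U, (q ≠ 0 ∧ q.natTrailingDegree = ν i) ∧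
      ∀ r ∈ U, r ≠ 0 → r.natTrailingDegree = ν i → q.natDegree ≤ r.natDegree := by
    intro i
    have hex : ∃ d, ∃ q ∈ U, (q ≠ 0 ∧ q.natTrailingDegree = ν i) ∧ q.natDegree = d := by
      obtain ⟨q, hq, h1, h2⟩ := h i
      exact ⟨_, q, hq, ⟨h1, h2⟩, rfl⟩
    obtain ⟨q, hq, h1, h2⟩ := Nat.find_spec hex
    exact ⟨q, hq, h1, fun r hr hr0 hrν => h2.symm ▸ Nat.find_min' hex ⟨r, hr, ⟨hr0, hrν⟩, rfl⟩⟩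
  choose q hqU hq hqmin using hmin
  have hcoeff : ∀ i, (q i).coeff (ν i) ≠ 0 := fun i => by
    rw [← (hq i).2]
    exact fun h => (hq i).1 (trailingCoeff_eq_zero.mp h)
  have hlt : ∀ i j, i < j → (q i).natDegree ≠ (q j).natDegree := by
    intro i j hij hd
    set t := (q i).leadingCoeff / (q j).leadingCoeff
    have hc : (q i - t • q j).coeff (ν i) = (q i).coeff (ν i) := by
      rw [coeff_sub, coeff_smul, coeff_eq_zero_of_lt_natTrailingDegree (p := q j)
        (by rw [(hq j).2]; exact hν hij), smul_zero, sub_zero]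
    have hne : q i - t • q j ≠ 0 := fun h0 => hcoeff i (by rw [← hc, h0, coeff_zero])
    have htr : (q i - t • q j).natTrailingDegree = ν i := by
      apply le_antisymm
      · exact natTrailingDegree_le_of_ne_zero (by rw [hc]; exact hcoeff i)
      · refine le_natTrailingDegree hne fun m hm => ?_
        rw [coeff_sub, coeff_smul, coeff_eq_zero_of_lt_natTrailingDegree (by rwa [(hq i).2]),
          coeff_eq_zero_of_lt_natTrailingDegree (by rw [(hq j).2]; exact hm.trans (hν hij)),
          smul_zero, sub_zero]
    have h1 := hqmin i _ (U.sub_mem (hqU i) (U.smul_mem t (hqU j))) hne htr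
    have h2 : (q i - t • q j).natDegree ≤ (q i).natDegree :=
      (natDegree_sub_le _ _).trans
        (max_le le_rfl ((natDegree_smul_le _ _).trans hd.symm.le))
    have h3 : (q i - t • q j).coeff (q i).natDegree = 0 := by
      rw [coeff_sub, coeff_smul, smul_eq_mul, hd, coeff_natDegree, ← hd, coeff_natDegree,
        div_mul_cancel₀ _ (leadingCoeff_ne_zero.mpr (hq j).1), sub_self]
    rw [le_antisymm h1 h2, coeff_natDegree, leadingCoeff_eq_zero] at h3
    exact hne h3
  have hinj : Function.Injective fun i => (q i).natDegree := by
    intro i j hij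
    rcases lt_trichotomy i j with h | h | h
    · exact absurd hij (hlt i j h)
    · exact h
    · exact absurd hij.symm (hlt j i h)
  obtain ⟨d, hd⟩ := exists_wronskian_eq hqU
  have hmono : X ^ (∑ j : Fin k, (j : ℕ)) * wronskian q =
      C (d * c) * X ^ (∑ j : Fin k, (j : ℕ) + m) := by
    rw [hd, hW, C_mul]
    ring
  have hlow := coeff_X_pow_mul_wronskian_ne_zero (p := q) hν.injective hcoeff
    (Or.inr fun i => by rw [← (hq i).2]; exact X_pow_natTrailingDegree_dvd _)
  have htop := coeff_X_pow_mul_wronskian_ne_zero (p := q) hinj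
    (fun i => leadingCoeff_ne_zero.mpr (hq i).1) (Or.inl fun i => le_rfl)
  rw [hmono, coeff_C_mul_X_pow] at hlow htop
  -- A one-term polynomial has nonzero coefficients in both of these degrees, so they coincide.
  have hsum : ∑ i, ν i = ∑ i, (q i).natDegree := by
    have h1 := (ite_ne_right_iff.mp hlow).1
    have h2 := (ite_ne_right_iff.mp htop).1
    omega
  have hle : ∀ i ∈ Finset.univ, ν i ≤ (q i).natDegree := fun i _ => by
    rw [← (hq i).2]
    exact natTrailingDegree_le_natDegree _
  have heq := (Finset.sum_eq_sum_iff_of_le hle).mp hsum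
  have hX : ∀ i, (X : ℂ[X]) ^ ν i ∈ U := by
    intro i
    have h1 : q i = (q i).coeff (ν i) • X ^ ν i := by
      ext m
      rw [coeff_smul, coeff_X_pow, smul_eq_mul]
      rcases lt_trichotomy m (ν i) with h | h | h
      · rw [coeff_eq_zero_of_lt_natTrailingDegree (by rwa [(hq i).2]), if_neg h.ne, mul_zero]
      · rw [h, if_pos rfl, mul_one]
      · rw [coeff_eq_zero_of_natDegree_lt (by rwa [← heq i (Finset.mem_univ i)]), if_neg h.ne',
          mul_zero]
    have h2 := U.smul_mem ((q i).coeff (ν i))⁻¹ (hqU i)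
    rw [h1, smul_smul, coeff_smul, coeff_X_pow_self, smul_eq_mul, mul_one,
      inv_mul_cancel₀ (hcoeff i), one_smul] at h2
    exact h2
  refine ⟨ν, hν, hνn, ?_⟩
  have hli : LinearIndependent ℂ fun i => (X : ℂ[X]) ^ ν i := by
    have := (basisMonomials ℂ).linearIndependent.comp ν hν.injective
    simpa [Function.comp_def, ← X_pow_eq_monomial] using this
  have hfin : FiniteDimensional ℂ U := FiniteDimensional.span_of_finite ℂ (Set.finite_range p)
  symm
  refine Submodule.eq_of_le_of_finrank_eq (Submodule.span_le.mpr ?_) ?_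
  · rintro _ ⟨i, rfl⟩
    exact hX i
  · rw [hU, finrank_span_eq_card hli, finrank_span_eq_card hp]

/-- The Wronskian of monomials is a monomial. -/
theorem exists_wronskian_X_pow {k : ℕ} (ν : Fin k → ℕ) :
    ∃ (c : ℂ) (m : ℕ), wronskian (fun i => (X : ℂ[X]) ^ ν i) = C c * X ^ m := by
  set W := wronskian (fun i => (X : ℂ[X]) ^ ν i) with hW
  set M := ∑ j : Fin k, (j : ℕ) with hM
  have h : X ^ M * W =
      C (Matrix.of fun i j : Fin k => ((ν i).descFactorial j : ℂ)).det * X ^ ∑ i, ν i := by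
    rw [hM, hW, X_pow_mul_wronskian, RingHom.map_det, mul_comm, ← Finset.prod_pow_eq_pow_sum,
      ← Matrix.det_mul_column]
    congr 1
    ext1 i j
    ext1 m
    rw [Matrix.of_apply, coeff_X_pow_mul_iterate_derivative]
    simp only [Matrix.of_apply, RingHom.mapMatrix_apply, Matrix.map_apply]
    rw [mul_comm (X ^ ν i), coeff_C_mul, coeff_X_pow]
    split_ifs with hm
    · rw [hm]
    · simp
  rcases le_or_gt M (∑ i, ν i) with hle | hlt
  · obtain ⟨l, hl⟩ := Nat.exists_eq_add_of_le hle
    refine ⟨(Matrix.of fun i j : Fin k => ((ν i).descFactorial j : ℂ)).det, l,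
      mul_left_cancel₀ (pow_ne_zero M X_ne_zero) (h.trans ?_)⟩
    rw [hl, pow_add, mul_left_comm]
  -- Here the left side has no term in degree `∑ ν i`, so the constant on the right is `0` and so is
  -- `W`.
  · have h0 := congrArg (fun r => coeff r (∑ i, ν i)) h
    simp only [coeff_X_pow_mul', coeff_C_mul_X_pow, if_neg (not_le.mpr hlt), if_true] at h0
    rw [← h0, C_0, zero_mul] at h
    refine ⟨0, 0, ?_⟩
    rw [C_0, zero_mul]
    exact (mul_eq_zero.mp h).resolve_left (pow_ne_zero M X_ne_zero)

/-! ### The covariants `H` and `T`, and their values on products of two linear powers -/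

theorem covH_eq {N : ℕ} (hN : N ≠ 0) (Q : ℂ[X]) :
    covH N Q = ((N : ℂ[X]) - 1) *
      (N * (Q * derivative (derivative Q)) - (N - 1) * derivative Q ^ 2) := by
  have hN' : (N : ℂ) ≠ 0 := Nat.cast_ne_zero.mpr hN
  have h1 : C ((N : ℂ) * (N - 1)) = (N : ℂ[X]) * (N - 1) := by simp
  have h2 : C ((N : ℂ) * (N - 1)) * C (((N : ℂ) - 1) / N) = ((N : ℂ[X]) - 1) * (N - 1) := by
    rw [← C_mul, mul_assoc, mul_comm, mul_assoc, div_mul_cancel₀ _ hN']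
    simp
  have h3 : derivative^[2] Q = derivative (derivative Q) := rfl
  rw [covH, mul_sub, ← mul_assoc _ (C _), h2, h1, h3]
  ring

theorem covT_eq {N : ℕ} (hN : N ≠ 0) (Q : ℂ[X]) :
    covT N Q = -((N : ℂ[X]) - 1) *
      (N ^ 2 * (Q ^ 2 * derivative (derivative (derivative Q))) -
        3 * N * (N - 2) * (Q * derivative Q * derivative (derivative Q)) +
        2 * (N - 1) * (N - 2) * derivative Q ^ 3) := by
  have hN' : (N : ℂ) ≠ 0 := Nat.cast_ne_zero.mpr hN
  have h1 : C (-((N : ℂ) ^ 2 * (N - 1))) = -((N : ℂ[X]) ^ 2 * ((N : ℂ[X]) - 1)) := by simp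
  have h2 : C (-((N : ℂ) ^ 2 * (N - 1))) * C (3 * (((N : ℂ) - 2) / N)) =
      -(3 * (N : ℂ[X]) * ((N : ℂ[X]) - 2) * ((N : ℂ[X]) - 1)) := by
    rw [← C_mul, show -((N : ℂ) ^ 2 * (N - 1)) * (3 * (((N : ℂ) - 2) / N)) =
      -(3 * N * (N - 2) * ((N : ℂ) - 1)) by field_simp]
    simp [map_ofNat C]
  have h3 : C (-((N : ℂ) ^ 2 * (N - 1))) * C (2 * (((N : ℂ) - 1) * (N - 2) / (N : ℂ) ^ 2)) =
      -(2 * ((N : ℂ[X]) - 1) * ((N : ℂ[X]) - 2) * ((N : ℂ[X]) - 1)) := by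
    rw [← C_mul, show -((N : ℂ) ^ 2 * (N - 1)) *
      (2 * (((N : ℂ) - 1) * (N - 2) / (N : ℂ) ^ 2)) =
      -(2 * (N - 1) * (N - 2) * ((N : ℂ) - 1)) by field_simp]
    simp [map_ofNat C]
  have h4 : derivative^[2] Q = derivative (derivative Q) := rfl
  have h5 : derivative^[3] Q = derivative (derivative (derivative Q)) := rfl
  rw [covT, mul_add, mul_sub, ← mul_assoc _ (C _), ← mul_assoc _ (C _), h2, h3, h1, h4, h5]
  ring

/-- `T` is the Jacobian covariant of `Q` and its Hessian. -/
theorem covT_eq_jacobian {N : ℕ} (hN : N ≠ 0) (Q : ℂ[X]) :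
    covT N Q = -(N * Q * derivative (covH N Q) -
      2 * (N - 2) * derivative Q * covH N Q) := by
  rw [covT_eq hN, covH_eq hN]
  simp only [derivative_mul, derivative_sub, derivative_one, derivative_natCast, derivative_pow]
  simp [map_ofNat C]
  ring

/-- The logarithmic derivative of `u ^ a v ^ b` with denominators cleared. -/
theorem derivative_linear_factors (a b : ℕ) (c p p0 q q0 : ℂ) {Q : ℂ[X]}
    (hQ : Q = C c * ((C p * X + C p0) ^ a * (C q * X + C q0) ^ b)) :
    (C p * X + C p0) * (C q * X + C q0) * derivative Q =
      Q * ((a : ℂ[X]) * C p * (C q * X + C q0) + (b : ℂ[X]) * C q * (C p * X + C p0)) := by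
  have h : ∀ (m : ℕ) (r s : ℂ), (C r * X + C s) * derivative ((C r * X + C s) ^ m) =
      (m : ℂ[X]) * C r * (C r * X + C s) ^ m := by
    intro m r s
    rcases m with _ | m
    · simp
    · rw [derivative_pow_succ]
      simp
      ring
  have h1 := h a p p0
  have h2 := h b q q0
  rw [hQ, derivative_C_mul, derivative_mul]
  linear_combination C c * (C q * X + C q0) ^ (b + 1) * h1 +
    C c * (C p * X + C p0) ^ (a + 1) * h2

theorem covH_linear_factors {a b : ℕ} (hN : a + b ≠ 0) (c p p0 q q0 : ℂ) {Q : ℂ[X]}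
    (hQ : Q = C c * ((C p * X + C p0) ^ a * (C q * X + C q0) ^ b)) :
    ((C p * X + C p0) * (C q * X + C q0)) ^ 2 * covH (a + b) Q =
      C (-((a : ℂ) + b - 1) * a * b * (p * q0 - q * p0) ^ 2) * Q ^ 2 := by
  have h := derivative_linear_factors a b c p p0 q q0 hQ
  have h' := congrArg derivative h
  simp only [derivative_mul, derivative_add, derivative_C, derivative_X, derivative_natCast,
    zero_mul, mul_one, zero_add, add_zero] at h'
  rw [covH_eq hN]
  simp only [C_mul, C_sub, C_neg, C_pow, C_add, C_1, map_natCast, Nat.cast_add]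
  linear_combination
    ((a : ℂ[X]) + b - 1) * (a + b) * Q * ((C p * X + C p0) * (C q * X + C q0)) * h' +
    ((a : ℂ[X]) + b - 1) * ((a + b) * Q * (((a : ℂ[X]) * C p * (C q * X + C q0) +
      (b : ℂ[X]) * C q * (C p * X + C p0)) -
        (C p * (C q * X + C q0) + C q * (C p * X + C p0))) -
      (a + b - 1) * ((C p * X + C p0) * (C q * X + C q0) * derivative Q +
        Q * ((a : ℂ[X]) * C p * (C q * X + C q0) + (b : ℂ[X]) * C q * (C p * X + C p0)))) * h

theorem covT_linear_factors {a b : ℕ} (hN : a + b ≠ 0) (c p p0 q q0 : ℂ) {Q : ℂ[X]}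
    (hQ : Q = C c * ((C p * X + C p0) ^ a * (C q * X + C q0) ^ b)) :
    ((C p * X + C p0) * (C q * X + C q0)) ^ 3 * covT (a + b) Q =
      C (-2 * (-((a : ℂ) + b - 1) * a * b * (p * q0 - q * p0) ^ 2) * (a - b) *
        (p * q0 - q * p0)) * Q ^ 3 := by
  have h := derivative_linear_factors a b c p p0 q q0 hQ
  have hH := covH_linear_factors hN c p p0 q q0 hQ
  have hH' := congrArg derivative hH
  -- From here only the constancy of `κ` matters: `T` comes from `Q` and `H` by the Jacobian
  -- formula.
  generalize -((a : ℂ) + b - 1) * a * b * (p * q0 - q * p0) ^ 2 = κ at hH hH' ⊢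
  simp only [derivative_mul, derivative_add, derivative_C, derivative_X, derivative_sq,
    zero_mul, mul_one, zero_add, add_zero, map_ofNat C] at hH'
  rw [covT_eq_jacobian hN]
  simp only [C_mul, C_sub, C_neg, map_natCast, Nat.cast_add, map_ofNat C]
  linear_combination
    -((a : ℂ[X]) + b) * Q * ((C p * X + C p0) * (C q * X + C q0)) * hH' +
    (2 * ((a : ℂ[X]) + b) * Q * (C p * (C q * X + C q0) + C q * (C p * X + C p0)) +
      2 * ((a : ℂ[X]) + b - 2) *
        ((C p * X + C p0) * (C q * X + C q0) * derivative Q)) * hH - 4 * C κ * Q ^ 2 * h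

theorem cov_of_linear_factors {a b : ℕ} (hN : a + b ≠ 0) {c p p0 q q0 : ℂ}
    (hu : C p * X + C p0 ≠ 0) (hv : C q * X + C q0 ≠ 0) (hc : c ≠ 0) {Q : ℂ[X]}
    (hQ : Q = C c * ((C p * X + C p0) ^ a * (C q * X + C q0) ^ b)) :
    covH (a + b) Q = 0 ∨ (covH (a + b) Q ≠ 0 ∧ ∃ t : ℂ, covJ2 (a + b) Q = RatFunc.C t) := by
  have hH := covH_linear_factors hN c p p0 q q0 hQ
  have hT := covT_linear_factors hN c p p0 q q0 hQ
  have huv := mul_ne_zero hu hv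
  generalize -((a : ℂ) + b - 1) * a * b * (p * q0 - q * p0) ^ 2 = κ at hH hT
  rcases eq_or_ne κ 0 with rfl | hκ
  · left
    rw [C_0, zero_mul] at hH
    exact (mul_eq_zero.mp hH).resolve_left (pow_ne_zero _ huv)
  have hQ0 : Q ≠ 0 := by
    rw [hQ]
    exact mul_ne_zero (C_ne_zero.mpr hc) (mul_ne_zero (pow_ne_zero _ hu) (pow_ne_zero _ hv))
  have hH0 : covH (a + b) Q ≠ 0 := by
    intro h0
    rw [h0, mul_zero] at hH
    exact mul_ne_zero (C_ne_zero.mpr hκ) (pow_ne_zero 2 hQ0) hH.symm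
  -- The constant of `T` is `-2 κ (a - b) (p q0 - q p0)` and that of `H` is `κ`; this is the square
  -- of the first over the cube of the second.
  refine Or.inr ⟨hH0, 4 * ((a - b) * (p * q0 - q * p0)) ^ 2 / κ, ?_⟩
  have key : covT (a + b) Q ^ 2 =
      C (4 * ((a - b) * (p * q0 - q * p0)) ^ 2 / κ) * covH (a + b) Q ^ 3 := by
    refine mul_left_cancel₀ (pow_ne_zero 6 huv) ?_
    have e1 : ∀ u T : ℂ[X], u ^ 6 * T ^ 2 = (u ^ 3 * T) ^ 2 := fun u T => by ring
    have e2 : ∀ u t H : ℂ[X], u ^ 6 * (t * H ^ 3) = t * (u ^ 2 * H) ^ 3 := fun u t H => by ring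
    rw [e1, e2, hH, hT, mul_pow (C _), mul_pow (C κ), ← C_pow, ← C_pow, ← mul_assoc, ← C_mul, ← pow_mul,
      ← pow_mul]
    congr 2
    field_simp
    ring
  rw [covJ2, key, map_mul, mul_div_assoc, div_self, mul_one, RatFunc.algebraMap_C]
  exact (map_ne_zero_iff _ (IsFractionRing.injective ℂ[X] (RatFunc ℂ))).mpr (pow_ne_zero 3 hH0)

/-! ### Bounding the number of roots by means of the covariants -/

/-- The number of distinct projective roots. -/
noncomputable def rootCount (N : ℕ) (Q : ℂ[X]) : ℕ :=
  Q.roots.toFinset.card + if Q.natDegree < N then 1 else 0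

theorem sum_rootMultiplicity (Q : ℂ[X]) :
    ∑ α ∈ Q.roots.toFinset, Q.rootMultiplicity α = Q.natDegree := by
  rw [(IsAlgClosed.splits Q).natDegree_eq_card_roots, ← Multiset.toFinset_sum_count_eq]
  exact Finset.sum_congr rfl fun α _ => (count_roots Q).symm

/-- Finite multiplicities add up to `deg Q ≤ N`, so at most two roots are finite; two of them
already use up degree `N`, and infinity is then not a root. -/
theorem rootCount_le_two_of_rootMultiplicity {N : ℕ} (hN : N ≠ 0) {Q : ℂ[X]}
    (hQN : Q.natDegree ≤ N) (h : ∀ α, Q.IsRoot α → N ≤ 2 * Q.rootMultiplicity α) :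
    rootCount N Q ≤ 2 := by
  have h1 : Q.roots.toFinset.card * N ≤ 2 * Q.natDegree := by
    rw [← sum_rootMultiplicity, Finset.mul_sum, ← smul_eq_mul]
    refine Finset.card_nsmul_le_sum _ _ _ fun α hα => h α ?_
    exact isRoot_of_mem_roots (Multiset.mem_toFinset.mp hα)
  have h2 : Q.roots.toFinset.card ≤ 2 := by
    by_contra! h3
    nlinarith [Nat.pos_of_ne_zero hN]
  rw [rootCount]
  split_ifs with hd
  · have : Q.roots.toFinset.card ≠ 2 := by
      intro h3
      rw [h3] at h1
      omega
    omega
  · omega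

theorem exists_eq_X_sub_C_pow_mul {Q : ℂ[X]} (hQ : Q ≠ 0) (α : ℂ) :
    ∃ q : ℂ[X], Q = (X - C α) ^ Q.rootMultiplicity α * q ∧ q.eval α ≠ 0 := by
  obtain ⟨q, hq, hd⟩ := exists_eq_pow_rootMultiplicity_mul_and_not_dvd Q hQ α
  exact ⟨q, hq, fun h => hd (dvd_iff_isRoot.mpr h)⟩

theorem X_sub_C_mul_derivative (α : ℂ) (m : ℕ) (q : ℂ[X]) :
    (X - C α) * derivative ((X - C α) ^ m * q) =
      (X - C α) ^ m * ((m : ℂ[X]) * q + (X - C α) * derivative q) := by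
  rcases m with _ | m
  · simp
  · rw [derivative_mul, derivative_pow_succ]
    simp
    ring

theorem X_sub_C_sq_mul_derivative (α : ℂ) (m : ℕ) (q : ℂ[X]) :
    (X - C α) ^ 2 * derivative (derivative ((X - C α) ^ m * q)) =
      (X - C α) ^ m * ((m : ℂ[X]) * ((m : ℂ[X]) - 1) * q + (X - C α) *
        (2 * (m : ℂ[X]) * derivative q + (X - C α) * derivative (derivative q))) := by
  have h := congrArg derivative (X_sub_C_mul_derivative α m q)
  have h0 := X_sub_C_mul_derivative α m q
  have h1 := X_sub_C_mul_derivative α m ((m : ℂ[X]) * q + (X - C α) * derivative q)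
  rw [derivative_mul] at h
  simp only [derivative_mul, derivative_add, derivative_sub, derivative_C, derivative_X,
    derivative_natCast, zero_mul, one_mul, zero_add, sub_zero] at h h0 h1 ⊢
  linear_combination (X - C α) * h + h1 - h0

theorem X_sub_C_cube_mul_derivative (α : ℂ) (m : ℕ) (q : ℂ[X]) :
    ∃ r : ℂ[X], (X - C α) ^ 3 * derivative (derivative (derivative ((X - C α) ^ m * q))) =
      (X - C α) ^ m * ((m : ℂ[X]) * ((m : ℂ[X]) - 1) * ((m : ℂ[X]) - 2) * q +
        (X - C α) * r) := by
  have h2 := X_sub_C_sq_mul_derivative α m q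
  generalize 2 * (m : ℂ[X]) * derivative q + (X - C α) * derivative (derivative q) = s at h2
  have h := congrArg derivative h2
  have h1 := X_sub_C_mul_derivative α m
    ((m : ℂ[X]) * ((m : ℂ[X]) - 1) * q + (X - C α) * s)
  refine ⟨(m : ℂ[X]) * s + (m : ℂ[X]) * ((m : ℂ[X]) - 1) * derivative q + s +
    (X - C α) * derivative s - 2 * s, ?_⟩
  generalize derivative (derivative ((X - C α) ^ m * q)) = D at *
  rw [derivative_mul, derivative_sq] at h
  simp only [derivative_add, derivative_sub, derivative_C, derivative_X,
    derivative_natCast, derivative_mul, derivative_one, zero_mul, mul_zero, one_mul, mul_one,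
    zero_add, sub_zero, sub_self, map_ofNat C] at h h1
  linear_combination (X - C α) * h + h1 - 2 * h2

theorem two_le_of_covH_ne_zero {N : ℕ} (hN : N ≠ 0) {Q : ℂ[X]} (hH : covH N Q ≠ 0) : 2 ≤ N := by
  by_contra h
  obtain rfl : N = 1 := by omega
  exact hH (by simp [covH])

/-- At a root of multiplicity `m` the lowest coefficient of `H` is a nonzero multiple of `(N - 1) m
(N - m)`. For `N = 1` this says nothing, but then `m ≥ 1` is enough. -/
theorem le_two_mul_rootMultiplicity_of_covH {N : ℕ} (hN : N ≠ 0) {Q : ℂ[X]} (hQ : Q ≠ 0)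
    (hH : covH N Q = 0) {α : ℂ} (hα : Q.IsRoot α) : N ≤ 2 * Q.rootMultiplicity α := by
  have hm := (rootMultiplicity_pos hQ).mpr hα
  obtain ⟨q, hq, hqα⟩ := exists_eq_X_sub_C_pow_mul hQ α
  generalize Q.rootMultiplicity α = m at *
  rcases (by omega : N = 1 ∨ 2 ≤ N) with rfl | hN2
  · omega
  have h1 := X_sub_C_mul_derivative α m q
  have h2 := X_sub_C_sq_mul_derivative α m q
  generalize 2 * (m : ℂ[X]) * derivative q + (X - C α) * derivative (derivative q) = r2 at h2
  rw [covH_eq hN] at hH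
  rw [hq] at hH
  have hX : (X - C α) ^ m ≠ 0 := pow_ne_zero _ (X_sub_C_ne_zero α)
  have key : (X - C α) ^ m * ((X - C α) ^ m * (((N : ℂ[X]) - 1) *
      ((N : ℂ[X]) * (q * ((m : ℂ[X]) * ((m : ℂ[X]) - 1) * q + (X - C α) * r2)) -
        ((N : ℂ[X]) - 1) * ((m : ℂ[X]) * q + (X - C α) * derivative q) ^ 2))) = 0 := by
    linear_combination (X - C α) ^ 2 * hH -
      ((N : ℂ[X]) - 1) * (N : ℂ[X]) * ((X - C α) ^ m * q) * h2 +
      ((N : ℂ[X]) - 1) ^ 2 * ((X - C α) * derivative ((X - C α) ^ m * q) +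
        (X - C α) ^ m * ((m : ℂ[X]) * q + (X - C α) * derivative q)) * h1
  have key2 := (mul_eq_zero.mp ((mul_eq_zero.mp key).resolve_left hX)).resolve_left hX
  have key3 := congrArg (eval α) key2
  simp only [eval_mul, eval_add, eval_sub, eval_pow, eval_X, eval_C, eval_natCast, eval_one,
    eval_zero, sub_self, zero_mul, add_zero] at key3
  have key4 : ((N : ℂ) - 1) * m * ((N : ℂ) - m) * q.eval α ^ 2 = 0 := by
    linear_combination -key3
  have hN1 : (N : ℂ) - 1 ≠ 0 := by
    rw [sub_ne_zero]
    exact_mod_cast (by omega : N ≠ 1)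
  have hm0 : (m : ℂ) ≠ 0 := Nat.cast_ne_zero.mpr hm.ne'
  have h3 := (mul_eq_zero.mp ((mul_eq_zero.mp key4).resolve_right
    (pow_ne_zero 2 hqα))).resolve_left (mul_ne_zero hN1 hm0)
  have : N = m := by exact_mod_cast sub_eq_zero.mp h3
  omega

/-- The lowest coefficient of `T` is a nonzero multiple of `(N - 1) m (N - m) (N - 2 m)`, so `m` is
`N` or `N / 2`. -/
theorem le_two_mul_rootMultiplicity_of_covT {N : ℕ} (hN : 2 ≤ N) {Q : ℂ[X]} (hQ : Q ≠ 0)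
    (hT : covT N Q = 0) {α : ℂ} (hα : Q.IsRoot α) : N ≤ 2 * Q.rootMultiplicity α := by
  have hm := (rootMultiplicity_pos hQ).mpr hα
  obtain ⟨q, hq, hqα⟩ := exists_eq_X_sub_C_pow_mul hQ α
  generalize Q.rootMultiplicity α = m at *
  have h1 := X_sub_C_mul_derivative α m q
  have h2 := X_sub_C_sq_mul_derivative α m q
  obtain ⟨r3, h3⟩ := X_sub_C_cube_mul_derivative α m q
  generalize 2 * (m : ℂ[X]) * derivative q + (X - C α) * derivative (derivative q) = r2 at h2
  generalize derivative q = r1 at h1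
  rw [covT_eq (by omega), hq] at hT
  have hX : ((X - C α) ^ m) ^ 3 ≠ 0 := pow_ne_zero _ (pow_ne_zero _ (X_sub_C_ne_zero α))
  generalize derivative (derivative (derivative ((X - C α) ^ m * q))) = D3 at *
  generalize derivative (derivative ((X - C α) ^ m * q)) = D2 at *
  generalize derivative ((X - C α) ^ m * q) = D1 at *
  have key : ((X - C α) ^ m) ^ 3 * (((N : ℂ[X]) - 1) *
      ((N : ℂ[X]) ^ 2 * (q ^ 2 * ((m : ℂ[X]) * ((m : ℂ[X]) - 1) * ((m : ℂ[X]) - 2) * q +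
        (X - C α) * r3)) -
      3 * (N : ℂ[X]) * ((N : ℂ[X]) - 2) * (q * ((m : ℂ[X]) * q + (X - C α) * r1) *
        ((m : ℂ[X]) * ((m : ℂ[X]) - 1) * q + (X - C α) * r2)) +
      2 * ((N : ℂ[X]) - 1) * ((N : ℂ[X]) - 2) * ((m : ℂ[X]) * q + (X - C α) * r1) ^ 3)) = 0 := by
    have e1 := congrArg (· ^ 3) h1
    have e2 := congrArg₂ (· * ·) h1 h2
    linear_combination -(X - C α) ^ 3 * hT -
      ((N : ℂ[X]) - 1) * (N : ℂ[X]) ^ 2 * ((X - C α) ^ m * q) ^ 2 * h3 +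
      3 * ((N : ℂ[X]) - 1) * (N : ℂ[X]) * ((N : ℂ[X]) - 2) * ((X - C α) ^ m * q) * e2 -
      2 * ((N : ℂ[X]) - 1) ^ 2 * ((N : ℂ[X]) - 2) * e1
  have key2 := (mul_eq_zero.mp key).resolve_left hX
  have key3 := congrArg (eval α) key2
  simp only [eval_mul, eval_add, eval_sub, eval_pow, eval_X, eval_C, eval_natCast, eval_one,
    eval_zero, eval_ofNat, sub_self, zero_mul, add_zero] at key3
  have key4 : ((N : ℂ) - 1) * m * q.eval α ^ 3 * (((N : ℂ) - m) * ((N : ℂ) - 2 * m)) = 0 := by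
    linear_combination key3 / 2
  have hN1 : (N : ℂ) - 1 ≠ 0 := by
    rw [sub_ne_zero]
    exact_mod_cast (by omega : N ≠ 1)
  have hm0 : (m : ℂ) ≠ 0 := Nat.cast_ne_zero.mpr hm.ne'
  rcases mul_eq_zero.mp ((mul_eq_zero.mp key4).resolve_left
    (mul_ne_zero (mul_ne_zero hN1 hm0) (pow_ne_zero 3 hqα))) with h | h
  · have : N = m := by exact_mod_cast sub_eq_zero.mp h
    omega
  · have : N = 2 * m := by exact_mod_cast sub_eq_zero.mp h
    omega

theorem ode_local {N m e : ℕ} {q s : ℂ[X]} {κ α : ℂ}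
    (hode : (N : ℂ[X]) * ((X - C α) ^ m * q) * derivative ((X - C α) ^ e * s) -
      ((N : ℂ[X]) - 2) * derivative ((X - C α) ^ m * q) * ((X - C α) ^ e * s) =
        C κ * ((X - C α) ^ e * s) ^ 2) :
    (X - C α) ^ (m + e) * ((N : ℂ[X]) * q * ((e : ℂ[X]) * s + (X - C α) * derivative s) -
      ((N : ℂ[X]) - 2) * ((m : ℂ[X]) * q + (X - C α) * derivative q) * s) =
      (X - C α) ^ (2 * e + 1) * (C κ * s ^ 2) := by
  have h1 := X_sub_C_mul_derivative α m q
  have h2 := X_sub_C_mul_derivative α e s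
  generalize derivative q = r1 at *
  generalize derivative s = r2 at *
  generalize derivative ((X - C α) ^ m * q) = Q1 at *
  generalize derivative ((X - C α) ^ e * s) = H1 at *
  linear_combination (X - C α) * hode - (N : ℂ[X]) * ((X - C α) ^ m * q) * h2 +
    ((N : ℂ[X]) - 2) * ((X - C α) ^ e * s) * h1

/-- In the equation `N Q h' - (N - 2) Q' h = κ h²`, the roots of `h` are the multiple roots of `Q`
with multiplicity one less. -/
theorem rootMultiplicity_of_ode {N : ℕ} (hN : 2 ≤ N) {Q h : ℂ[X]} (hQ : Q ≠ 0) (hh : h ≠ 0)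
    {κ : ℂ} (hκ : κ ≠ 0)
    (hode : (N : ℂ[X]) * Q * derivative h - ((N : ℂ[X]) - 2) * derivative Q * h = C κ * h ^ 2)
    (α : ℂ) : h.rootMultiplicity α = Q.rootMultiplicity α - 1 := by
  obtain ⟨q, hq, hqα⟩ := exists_eq_X_sub_C_pow_mul hQ α
  obtain ⟨s, hs, hsα⟩ := exists_eq_X_sub_C_pow_mul hh α
  generalize Q.rootMultiplicity α = m at *
  generalize h.rootMultiplicity α = e at *
  rw [hq, hs] at hode
  have key := ode_local hode
  have hX : (X - C α) ≠ 0 := X_sub_C_ne_zero α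
  -- These are the exponents of `X - C α` on the two sides. If the left one is smaller, its leading
  -- factor `N e - (N - 2) m` must vanish while `m ≤ e`, so `m = e = 0`, which agrees with truncated
  -- subtraction. If it is larger, the right side could not be nonzero after cancellation.
  rcases lt_trichotomy (m + e) (2 * e + 1) with hlt | heq | hgt
  · obtain ⟨l, hl⟩ : ∃ l, 2 * e + 1 = m + e + (l + 1) := ⟨e - m, by omega⟩
    rw [hl, pow_add _ (m + e) (l + 1), mul_assoc (_ ^ (m + e))] at key
    have key2 := congrArg (eval α) (mul_left_cancel₀ (pow_ne_zero _ hX) key)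
    simp only [eval_mul, eval_add, eval_sub, eval_pow, eval_X, eval_C, eval_natCast,
      eval_ofNat, sub_self, zero_mul, add_zero, pow_succ, mul_zero] at key2
    have key3 : q.eval α * s.eval α * ((N : ℂ) * e - (N - 2) * m) = 0 := by
      linear_combination key2
    have key4 := (mul_eq_zero.mp key3).resolve_left (mul_ne_zero hqα hsα)
    have key5 : N * e + 2 * m = N * m := by
      have : (N : ℂ) * e + 2 * m = N * m := by linear_combination key4
      exact_mod_cast this
    have : N * m ≤ N * e := Nat.mul_le_mul_left N (by omega)
    have hm : m = 0 := by omega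
    subst hm
    have : e = 0 := by
      rcases Nat.mul_eq_zero.mp (by omega : N * e = 0) with h | h
      · omega
      · exact h
    omega
  · omega
  · obtain ⟨l, hl⟩ : ∃ l, m + e = 2 * e + 1 + (l + 1) := ⟨m + e - (2 * e + 1) - 1, by omega⟩
    rw [hl, pow_add _ (2 * e + 1) (l + 1), mul_assoc (_ ^ (2 * e + 1))] at key
    have key2 := congrArg (eval α) (mul_left_cancel₀ (pow_ne_zero _ hX) key)
    simp only [eval_mul, eval_sub, eval_pow, eval_X, eval_C, sub_self, pow_succ, mul_zero,
      zero_mul, pow_zero, one_mul] at key2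
    exact absurd key2.symm (mul_ne_zero hκ (mul_ne_zero hsα hsα))

/-- The same comparison at infinity: after multiplication by `X`, either the two top degrees match
or the leading factor `N deg h - (N - 2) deg Q` vanishes. -/
theorem natDegree_of_ode {N : ℕ} {Q h : ℂ[X]} (hQ : Q ≠ 0) (hh : h ≠ 0)
    {κ : ℂ} (hκ : κ ≠ 0)
    (hode : (N : ℂ[X]) * Q * derivative h - ((N : ℂ[X]) - 2) * derivative Q * h = C κ * h ^ 2) :
    h.natDegree + 1 = Q.natDegree ∨
      N * h.natDegree + 2 * Q.natDegree = N * Q.natDegree := by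
  have hE : ∀ p : ℂ[X], (X * derivative p).natDegree ≤ p.natDegree := fun p =>
    natDegree_le_iff_coeff_eq_zero.mpr fun m hm => by
      have := coeff_X_pow_mul_iterate_derivative p 1 m
      rw [pow_one, Function.iterate_one] at this
      rw [this, coeff_eq_zero_of_natDegree_lt hm, mul_zero]
  have hEc : ∀ p : ℂ[X], (X * derivative p).coeff p.natDegree = p.natDegree * p.leadingCoeff := by
    intro p
    have := coeff_X_pow_mul_iterate_derivative p 1 p.natDegree
    rwa [pow_one, Function.iterate_one, Nat.descFactorial_one] at this
  set F := C (N : ℂ) * (Q * (X * derivative h)) - C ((N : ℂ) - 2) * (X * derivative Q * h) with hF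
  have hFX : F = X * (C κ * h ^ 2) := by
    rw [← hode, hF]
    simp only [C_sub, map_natCast, map_ofNat C]
    ring
  have hFd : F.natDegree ≤ Q.natDegree + h.natDegree :=
    (natDegree_sub_le _ _).trans (max_le
      ((natDegree_C_mul_le _ _).trans (natDegree_mul_le_of_le le_rfl (hE h)))
      ((natDegree_C_mul_le _ _).trans (natDegree_mul_le_of_le (hE Q) le_rfl)))
  have hFc : F.coeff (Q.natDegree + h.natDegree) =
      Q.leadingCoeff * h.leadingCoeff * (N * h.natDegree - (N - 2) * Q.natDegree) := by
    rw [hF, coeff_sub, coeff_C_mul, coeff_C_mul,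
      coeff_mul_add_eq_of_natDegree_le le_rfl (hE h),
      coeff_mul_add_eq_of_natDegree_le (hE Q) le_rfl, hEc, hEc, coeff_natDegree, coeff_natDegree]
    ring
  have hdeg : F.natDegree = 2 * h.natDegree + 1 := by
    rw [hFX, natDegree_X_mul (mul_ne_zero (C_ne_zero.mpr hκ) (pow_ne_zero 2 hh)),
      natDegree_C_mul hκ, natDegree_pow]
  rcases eq_or_ne (h.natDegree + 1) Q.natDegree with heq | hne
  · exact Or.inl heq
  · right
    rw [coeff_eq_zero_of_natDegree_lt (by omega)] at hFc
    have := (mul_eq_zero.mp hFc.symm).resolve_left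
      (mul_ne_zero (leadingCoeff_ne_zero.mpr hQ) (leadingCoeff_ne_zero.mpr hh))
    have h3 : (N : ℂ) * h.natDegree + 2 * Q.natDegree = N * Q.natDegree := by
      linear_combination this
    exact_mod_cast h3

/-- With `r` finite roots, `deg h = deg Q - r`. The alternatives at infinity become `r = 1` and `2
deg Q = N r`; in the latter `r ≤ 2`, and `r = 2` forces `deg Q = N`. -/
theorem rootCount_le_two_of_ode {N : ℕ} (hN : 2 ≤ N) {Q h : ℂ[X]} (hQ : Q ≠ 0)
    (hQN : Q.natDegree ≤ N) (hh : h ≠ 0) {κ : ℂ} (hκ : κ ≠ 0)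
    (hode : (N : ℂ[X]) * Q * derivative h - ((N : ℂ[X]) - 2) * derivative Q * h = C κ * h ^ 2) :
    rootCount N Q ≤ 2 := by
  have hmult := rootMultiplicity_of_ode hN hQ hh hκ hode
  have hsum : h.natDegree + Q.roots.toFinset.card = Q.natDegree := by
    have h1 : h.natDegree = ∑ α ∈ Q.roots.toFinset, h.rootMultiplicity α := by
      rw [← sum_rootMultiplicity]
      refine Finset.sum_subset (fun α hα => ?_) (fun α _ hα => ?_)
      · rw [Multiset.mem_toFinset, mem_roots hh, ← rootMultiplicity_pos hh, hmult] at hα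
        rw [Multiset.mem_toFinset, mem_roots hQ, ← rootMultiplicity_pos hQ]
        omega
      · rw [Multiset.mem_toFinset, ← Multiset.count_pos, count_roots] at hα
        omega
    rw [h1, ← sum_rootMultiplicity Q, Finset.card_eq_sum_ones, ← Finset.sum_add_distrib]
    refine Finset.sum_congr rfl fun α hα => ?_
    rw [Multiset.mem_toFinset, mem_roots hQ, ← rootMultiplicity_pos hQ] at hα
    rw [hmult]
    omega
  rw [rootCount]
  rcases natDegree_of_ode hQ hh hκ hode with h1 | h1
  · split_ifs <;> omega
  · have h2 : 2 * Q.natDegree = N * Q.roots.toFinset.card := by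
      rw [← hsum] at h1 ⊢
      linarith
    have h3 : Q.roots.toFinset.card ≤ 2 := by
      by_contra! h3
      nlinarith
    split_ifs with hd
    · have : Q.roots.toFinset.card ≠ 2 := by
        intro h4
        rw [h4] at h2
        omega
      omega
    · omega

/-- After scaling, `H ^ 2` divides `T ^ 2`, hence `H` divides `T`; the quotient is the square root
of `H`. -/
theorem exists_eq_sq_of_sq_eq_cube {H T : ℂ[X]} (hH : H ≠ 0) {c : ℂ} (hc : c ≠ 0)
    (h : T ^ 2 = C c * H ^ 3) : ∃ (g : ℂ[X]) (t : ℂ), t ≠ 0 ∧ H = g ^ 2 ∧ T = C t * g ^ 3 := by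
  obtain ⟨t, ht⟩ := IsAlgClosed.exists_pow_nat_eq c (n := 2) (by norm_num)
  have ht0 : t ≠ 0 := by
    rintro rfl
    exact hc (by rw [← ht]; norm_num)
  have hS : (C t⁻¹ * T) ^ 2 = H ^ 3 := by
    rw [mul_pow, h, ← ht, ← C_pow, ← mul_assoc, ← C_mul, inv_pow,
      inv_mul_cancel₀ (pow_ne_zero 2 ht0), C_1, one_mul]
  have hdvd : H ∣ C t⁻¹ * T := by
    rw [← IsIntegrallyClosed.pow_dvd_pow_iff (n := 2) two_ne_zero, hS]
    exact pow_dvd_pow H (by norm_num)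
  obtain ⟨g, hg⟩ := hdvd
  have hHg : H = g ^ 2 := by
    refine mul_left_cancel₀ (pow_ne_zero 2 hH) ?_
    rw [← mul_pow, ← hg, hS]
    ring
  refine ⟨g, t, ht0, hHg, ?_⟩
  have : T = C t * (C t⁻¹ * T) := by
    rw [← mul_assoc, ← C_mul, mul_inv_cancel₀ ht0, C_1, one_mul]
  rw [this, hg, hHg]
  ring

theorem rootCount_le_two_of_cov {N : ℕ} (hN : N ≠ 0) {Q : ℂ[X]} (hQ : Q ≠ 0)
    (hQN : Q.natDegree ≤ N)
    (h : covH N Q = 0 ∨ (covH N Q ≠ 0 ∧ ∃ c : ℂ, covJ2 N Q = RatFunc.C c)) :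
    rootCount N Q ≤ 2 := by
  rcases h with hH | ⟨hH, c, hc⟩
  · exact rootCount_le_two_of_rootMultiplicity hN hQN fun α hα =>
      le_two_mul_rootMultiplicity_of_covH hN hQ hH hα
  have hN2 := two_le_of_covH_ne_zero hN hH
  have hTH : covT N Q ^ 2 = C c * covH N Q ^ 3 := by
    have hinj := IsFractionRing.injective ℂ[X] (RatFunc ℂ)
    apply hinj
    rw [covJ2, div_eq_iff ((map_ne_zero_iff _ hinj).mpr (pow_ne_zero 3 hH))] at hc
    rw [hc, map_mul, RatFunc.algebraMap_C]
  rcases eq_or_ne c 0 with rfl | hc0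
  · rw [C_0, zero_mul] at hTH
    exact rootCount_le_two_of_rootMultiplicity hN hQN fun α hα =>
      le_two_mul_rootMultiplicity_of_covT hN2 hQ (pow_eq_zero_iff two_ne_zero |>.mp hTH) hα
  · obtain ⟨g, t, ht, hg, hT⟩ := exists_eq_sq_of_sq_eq_cube hH hc0 hTH
    have hg0 : g ≠ 0 := by
      rintro rfl
      exact hH (by rw [hg]; simp)
    have hJ := covT_eq_jacobian hN Q
    rw [hT, hg, derivative_sq, map_ofNat C] at hJ
    -- With `H = g ^ 2`, `T = t g ^ 3`, the Jacobian formula has a common factor `2 g`; dividing by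
    -- it gives the equation with `κ = -t / 2`.
    refine rootCount_le_two_of_ode hN2 hQ hQN hg0 (κ := -t / 2) (by simpa using ht) ?_
    have h2 : C (-t / 2) * 2 = (-C t : ℂ[X]) := by
      rw [← map_ofNat C, ← C_mul, div_mul_cancel₀ _ two_ne_zero, C_neg]
    refine mul_left_cancel₀ (mul_ne_zero two_ne_zero hg0 : 2 * g ≠ 0) ?_
    linear_combination hJ - g ^ 3 * h2

/-! ### Roots on the projective line and reduction to a monomial -/

theorem smul_mk_eq (g : SL2) {v : Fin 2 → ℂ} (hv : v ≠ 0) :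
    ∃ h, g • (Projectivization.mk ℂ v hv : CP1) = Projectivization.mk ℂ (g.1 *ᵥ v) h :=
  ⟨_, rfl⟩

theorem mk_eq_inftyPt {v : Fin 2 → ℂ} (hv : v ≠ 0) :
    (Projectivization.mk ℂ v hv : CP1) = inftyPt ↔ v 1 = 0 := by
  rw [inftyPt, Projectivization.mk_eq_mk_iff']
  constructor
  · rintro ⟨a, rfl⟩
    simp
  · intro h
    exact ⟨v 0, (eq_smul_infty h).symm⟩

theorem mk_eq_finPt {v : Fin 2 → ℂ} (hv : v ≠ 0) (z : ℂ) :
    (Projectivization.mk ℂ v hv : CP1) = finPt z ↔ v 0 = z * v 1 := by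
  rw [finPt, Projectivization.mk_eq_mk_iff']
  constructor
  · rintro ⟨a, rfl⟩
    simp [mul_comm]
  · intro h
    refine ⟨v 1, ?_⟩
    ext i
    fin_cases i
    · simp [h, mul_comm]
    · simp

theorem finPt_injective : Function.Injective finPt := by
  intro z w h
  rw [finPt, mk_eq_finPt] at h
  simpa using h

theorem finPt_ne_inftyPt (z : ℂ) : finPt z ≠ inftyPt := by
  rw [finPt, Ne, mk_eq_inftyPt]
  simp

theorem eq_finPt_or_eq_inftyPt (x : CP1) : (∃ z, x = finPt z) ∨ x = inftyPt := by
  induction x using Projectivization.ind with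
  | h v hv =>
    by_cases h : v 1 = 0
    · exact Or.inr ((mk_eq_inftyPt hv).mpr h)
    · exact Or.inl ⟨v 0 / v 1, (mk_eq_finPt hv _).mpr (div_mul_cancel₀ _ h).symm⟩

theorem degree_lt_iff_coeff {N : ℕ} {Q : ℂ[X]} (hQN : Q.natDegree ≤ N) :
    Q.degree < N ↔ Q.coeff N = 0 := by
  rw [degree_lt_iff_coeff_zero]
  refine ⟨fun h => h N le_rfl, fun h m hm => ?_⟩
  rcases hm.eq_or_lt with rfl | hm
  · exact h
  · exact coeff_eq_zero_of_natDegree_lt (by omega)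

theorem finPt_mem_projRoots {N : ℕ} {Q : ℂ[X]} {z : ℂ} :
    finPt z ∈ projRoots N Q ↔ Q.IsRoot z := by
  simp [projRoots, finPt_injective.eq_iff, finPt_ne_inftyPt]

theorem inftyPt_mem_projRoots {N : ℕ} {Q : ℂ[X]} :
    inftyPt ∈ projRoots N Q ↔ Q.degree < N := by
  simp [projRoots, fun z => (finPt_ne_inftyPt z).symm]

/-- Homogeneous coordinates treat infinity like any other root, which makes equivariance of the root
set immediate. -/
theorem mk_mem_projRoots {N : ℕ} {Q : ℂ[X]} (hQN : Q.natDegree ≤ N) {v : Fin 2 → ℂ}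
    (hv : v ≠ 0) : (Projectivization.mk ℂ v hv : CP1) ∈ projRoots N Q ↔ formEval N Q v = 0 := by
  by_cases h : v 1 = 0
  · have h0 : v 0 ≠ 0 := by
      intro h0
      rw [eq_smul_infty h, h0, zero_smul] at hv
      exact hv rfl
    rw [(mk_eq_inftyPt hv).mpr h, inftyPt_mem_projRoots, degree_lt_iff_coeff hQN,
      eq_smul_infty h, formEval_smul, formEval_infty]
    simp [h0]
  · rw [(mk_eq_finPt hv (v 0 / v 1)).mpr (div_mul_cancel₀ _ h).symm, finPt_mem_projRoots,
      eq_smul_finite h, formEval_smul, formEval_finite hQN]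
    simp [h, IsRoot]

theorem mem_projRoots_act {N : ℕ} {Q : ℂ[X]} (hQN : Q.natDegree ≤ N) (g : SL2) (x : CP1) :
    x ∈ projRoots N (act N g Q) ↔ g • x ∈ projRoots N Q := by
  induction x using Projectivization.ind with
  | h v hv =>
    obtain ⟨hgv, h⟩ := smul_mk_eq g hv
    rw [h, mk_mem_projRoots (natDegree_act_le N g Q), mk_mem_projRoots hQN, formEval_act]

theorem projRoots_smul {N : ℕ} {Q : ℂ[X]} {c : ℂ} (hc : c ≠ 0) :
    projRoots N (c • Q) = projRoots N Q := by
  ext x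
  simp only [projRoots, Set.mem_ofPred_eq, IsRoot, smul_eq_C_mul, eval_mul, eval_C, mul_eq_zero,
    hc, false_or, degree_C_mul hc]

theorem projRoots_eq {N : ℕ} {Q : ℂ[X]} (hQ : Q ≠ 0) :
    projRoots N Q = finPt '' Q.roots.toFinset ∪ (if Q.natDegree < N then {inftyPt} else ∅) := by
  ext x
  have h1 : Q.degree < N ↔ Q.natDegree < N := by
    rw [natDegree_lt_iff_degree_lt hQ]
  simp only [projRoots, Set.mem_ofPred_eq, h1, Set.mem_union, Set.mem_image, Finset.mem_coe,
    Multiset.mem_toFinset, mem_roots hQ]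
  refine or_congr ⟨?_, ?_⟩ ?_
  · rintro ⟨z, hz, rfl⟩
    exact ⟨z, hz, rfl⟩
  · rintro ⟨z, hz, rfl⟩
    exact ⟨z, hz, rfl⟩
  · split_ifs with h <;> simp [h]

theorem finite_projRoots {N : ℕ} {Q : ℂ[X]} (hQ : Q ≠ 0) : (projRoots N Q).Finite := by
  rw [projRoots_eq hQ]
  refine ((Finset.finite_toSet _).image _).union ?_
  split_ifs <;> simp

theorem ncard_projRoots {N : ℕ} {Q : ℂ[X]} (hQ : Q ≠ 0) :
    (projRoots N Q).ncard = rootCount N Q := by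
  rw [projRoots_eq hQ, Set.ncard_union_eq _ ((Finset.finite_toSet _).image _) _,
    Set.ncard_image_of_injective _ finPt_injective, Set.ncard_coe_finset, rootCount]
  · split_ifs <;> simp
  · rw [Set.disjoint_left]
    rintro _ ⟨z, -, rfl⟩
    split_ifs
    · exact finPt_ne_inftyPt z
    · simp
  · split_ifs <;> simp

theorem rootCount_pos {N : ℕ} (hN : N ≠ 0) {Q : ℂ[X]} (hQ : Q ≠ 0) (hQN : Q.natDegree ≤ N) :
    0 < rootCount N Q := by
  rw [rootCount]
  split_ifs with h
  · omega
  · obtain ⟨z, hz⟩ := IsAlgClosed.exists_root Q (fun h0 => by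
      rw [degree_eq_natDegree hQ] at h0
      have : Q.natDegree = 0 := by exact_mod_cast h0
      omega)
    exact Nat.add_pos_left (Finset.card_pos.mpr
      ⟨z, Multiset.mem_toFinset.mpr ((mem_roots hQ).mpr hz)⟩) _

/-- `SL₂` is transitive on ordered pairs of distinct points. -/
theorem exists_smul_eq_pair {r s : CP1} (hrs : r ≠ s) :
    ∃ g : SL2, g • finPt 0 = r ∧ g • inftyPt = s :=
  MulAction.is_two_pretransitive_iff.mp
    (inferInstance : MulAction.IsMultiplyPretransitive SL2 CP1 2) (finPt_ne_inftyPt 0) hrs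

theorem exists_ne_point (r : CP1) : ∃ s : CP1, r ≠ s := by
  by_cases h : r = inftyPt
  · exact ⟨finPt 0, fun h' => finPt_ne_inftyPt 0 (h'.symm.trans h)⟩
  · exact ⟨inftyPt, h⟩

/-- A form with at most two distinct roots can be moved to a monomial. -/
theorem exists_act_eq_X_pow {N : ℕ} {Q : ℂ[X]} (hQ : Q ≠ 0) (hQN : Q.natDegree ≤ N)
    (h : (projRoots N Q).ncard = 1 ∨ (projRoots N Q).ncard = 2) :
    ∃ (g : SL2) (c : ℂ) (m : ℕ), c ≠ 0 ∧ m ≤ N ∧ act N g Q = C c * X ^ m := by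
  -- A single root is padded by an arbitrary second point; the pair is then moved to `0` and `∞`.
  obtain ⟨r, s, hrs, hsub⟩ : ∃ r s : CP1, r ≠ s ∧ projRoots N Q ⊆ {r, s} := by
    rcases h with h | h
    · obtain ⟨r, hr⟩ := Set.ncard_eq_one.mp h
      obtain ⟨s, hs⟩ := exists_ne_point r
      exact ⟨r, s, hs, by rw [hr]; simp⟩
    · obtain ⟨r, s, hrs, hr⟩ := Set.ncard_eq_two.mp h
      exact ⟨r, s, hrs, hr.le⟩
  obtain ⟨g, hg0, hg1⟩ := exists_smul_eq_pair hrs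
  have hP := act_ne_zero hQN hQ g
  have hroot : ∀ z, (act N g Q).IsRoot z → z = 0 := by
    intro z hz
    have h1 := hsub ((mem_projRoots_act hQN g _).mp (finPt_mem_projRoots.mpr hz))
    rcases h1 with h1 | h1
    · rw [← hg0] at h1
      exact finPt_injective (MulAction.injective g h1)
    · rw [Set.mem_singleton_iff, ← hg1] at h1
      exact absurd (MulAction.injective g h1) (finPt_ne_inftyPt z)
  obtain ⟨q, hq, hq0⟩ := exists_eq_X_sub_C_pow_mul hP 0
  rw [C_0, sub_zero] at hq
  have hqd : q.degree = 0 := by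
    by_contra hd
    obtain ⟨z, hz⟩ := IsAlgClosed.exists_root q hd
    have : (act N g Q).IsRoot z := by
      rw [hq, IsRoot, eval_mul, hz, mul_zero]
    rw [hroot z this] at hz
    exact hq0 hz
  have hqC := eq_C_of_degree_eq_zero hqd
  have hc : q.coeff 0 ≠ 0 := by rwa [coeff_zero_eq_eval_zero]
  refine ⟨g, q.coeff 0, _, hc, ?_, by rwa [mul_comm, ← hqC]⟩
  have h1 := natDegree_act_le N g Q
  rw [hq, hqC, natDegree_mul_C hc, natDegree_X_pow] at h1
  exact h1

theorem map_span_eq_iff {N : ℕ} {Q : ℂ[X]} (hQ : Q ≠ 0) (hQN : Q.natDegree ≤ N) (g : SL2) :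
    (Submodule.span ℂ {Q}).map (act N g) = Submodule.span ℂ {Q} ↔
      ∃ c : ℂ, c ≠ 0 ∧ act N g Q = c • Q := by
  rw [Submodule.map_span, Set.image_singleton]
  constructor
  · intro h
    obtain ⟨c, hc⟩ := Submodule.mem_span_singleton.mp
      (h ▸ Submodule.mem_span_singleton_self (R := ℂ) (act N g Q))
    refine ⟨c, ?_, hc.symm⟩
    rintro rfl
    exact act_ne_zero hQN hQ g (by rw [← hc, zero_smul])
  · rintro ⟨c, hc, h⟩
    rw [h]
    exact Submodule.span_singleton_smul_eq (IsUnit.mk0 c hc) Q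

/-! ### Stabilizers -/

/-- The form `z ^ m` has root `0` with multiplicity `m` and root `∞` with multiplicity `N - m`. A
symmetry fixes each of these that is a root, or swaps them when the multiplicities are equal. -/
theorem linear_factors_eq_X_pow_iff {N m : ℕ} (hm : m ≤ N) {a b c d : ℂ}
    (hdet : a * d - b * c = 1) :
    (∃ t : ℂ, t ≠ 0 ∧ (C a * X + C b) ^ m * (C c * X + C d) ^ (N - m) = C t * X ^ m) ↔
      ((b = 0 ∨ m = 0) ∧ (c = 0 ∨ m = N)) ∨ (a = 0 ∧ d = 0 ∧ 2 * m = N) := by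
  have hnum : (b = 0 ∨ m = 0) → a ^ m ≠ 0 ∧ (C a * X + C b) ^ m = C (a ^ m) * X ^ m := by
    rintro (rfl | rfl)
    · refine ⟨pow_ne_zero _ ?_, by rw [C_0, add_zero, mul_pow, C_pow]⟩
      rintro rfl
      simp at hdet
    · simp
  constructor
  · rintro ⟨t, ht, h⟩
    by_cases hb : b = 0 ∨ m = 0
    · left
      refine ⟨hb, ?_⟩
      by_contra! hc
      obtain ⟨ha, h1⟩ := hnum hb
      rw [h1] at h
      have h2 : C (a ^ m) * (C c * X + C d) ^ (N - m) = C t := by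
        refine mul_left_cancel₀ (pow_ne_zero m X_ne_zero) ?_
        linear_combination h
      have h3 := congrArg (eval (-d / c)) h2
      have h4 : c * (-d / c) + d = 0 := by
        rw [mul_div_cancel₀ _ hc.1, neg_add_cancel]
      simp only [eval_mul, eval_pow, eval_add, eval_C, eval_X, h4] at h3
      rw [zero_pow (by omega), mul_zero] at h3
      exact ht h3.symm
    · right
      push Not at hb
      have h0 := congrArg (eval 0) h
      simp only [eval_mul, eval_pow, eval_add, eval_C, eval_X, mul_zero, zero_add] at h0
      rw [zero_pow hb.2, mul_zero] at h0
      have hd := (mul_eq_zero.mp h0).resolve_left (pow_ne_zero _ hb.1)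
      have hd0 : d = 0 := eq_zero_of_pow_eq_zero hd
      have hc : c ≠ 0 := by
        rintro rfl
        simp [hd0] at hdet
      have ha : a = 0 := by
        by_contra ha
        have h3 := congrArg (eval (-b / a)) h
        have h4 : a * (-b / a) + b = 0 := by
          rw [mul_div_cancel₀ _ ha, neg_add_cancel]
        simp only [eval_mul, eval_pow, eval_add, eval_C, eval_X, h4] at h3
        rw [zero_pow hb.2, zero_mul] at h3
        exact mul_ne_zero ht (pow_ne_zero _ (div_ne_zero (neg_ne_zero.mpr hb.1) ha)) h3.symm
      refine ⟨ha, hd0, ?_⟩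
      rw [ha, hd0, C_0, zero_mul, zero_add, add_zero, mul_pow, ← C_pow, ← C_pow, ← mul_assoc,
        ← C_mul] at h
      have h5 := congrArg natDegree h
      rw [natDegree_C_mul_X_pow _ _ (mul_ne_zero (pow_ne_zero _ hb.1) (pow_ne_zero _ hc)),
        natDegree_C_mul_X_pow _ _ ht] at h5
      omega
  · rintro (⟨hb, hc⟩ | ⟨rfl, rfl, hN⟩)
    · obtain ⟨ha, h1⟩ := hnum hb
      have h2 : d ^ (N - m) ≠ 0 ∧ (C c * X + C d) ^ (N - m) = C (d ^ (N - m)) := by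
        rcases hc with rfl | rfl
        · refine ⟨pow_ne_zero _ ?_, by rw [C_0, zero_mul, zero_add, C_pow]⟩
          rintro rfl
          simp at hdet
        · simp
      refine ⟨a ^ m * d ^ (N - m), mul_ne_zero ha h2.1, ?_⟩
      rw [h1, h2.2, C_mul]
      ring
    · have hbc : b * c ≠ 0 := by
        intro h0
        simp [h0] at hdet
      refine ⟨(b * c) ^ m, pow_ne_zero _ hbc, ?_⟩
      rw [show N - m = m by omega]
      simp
      ring

theorem mulVec_pair (g : SL2) (x y : ℂ) :
    g.1 *ᵥ ![x, y] = ![g 0 0 * x + g 0 1 * y, g 1 0 * x + g 1 1 * y] := by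
  ext i
  fin_cases i <;> simp [Matrix.mulVec, dotProduct]

theorem smul_inftyPt_eq_inftyPt (g : SL2) : g • inftyPt = inftyPt ↔ g 1 0 = 0 := by
  conv_lhs => lhs; rw [inftyPt]
  obtain ⟨h, he⟩ := smul_mk_eq g (v := ![1, 0]) (by simp)
  rw [he, mk_eq_inftyPt, mulVec_pair]
  simp

theorem smul_inftyPt_eq_finPt (g : SL2) : g • inftyPt = finPt 0 ↔ g 0 0 = 0 := by
  rw [inftyPt]
  obtain ⟨h, he⟩ := smul_mk_eq g (v := ![1, 0]) (by simp)
  rw [he, mk_eq_finPt, mulVec_pair]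
  simp

theorem smul_finPt_eq_inftyPt (g : SL2) (z : ℂ) :
    g • finPt z = inftyPt ↔ g 1 0 * z + g 1 1 = 0 := by
  rw [finPt]
  obtain ⟨h, he⟩ := smul_mk_eq g (v := ![z, 1]) (by simp)
  rw [he, mk_eq_inftyPt, mulVec_pair]
  simp

theorem smul_finPt_eq_finPt (g : SL2) (z w : ℂ) :
    g • finPt z = finPt w ↔ g 0 0 * z + g 0 1 = w * (g 1 0 * z + g 1 1) := by
  conv_lhs => lhs; rw [finPt]
  obtain ⟨h, he⟩ := smul_mk_eq g (v := ![z, 1]) (by simp)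
  rw [he, mk_eq_finPt, mulVec_pair]
  simp

theorem act_monomial_proportional_iff {N m : ℕ} (hm : m ≤ N) {c : ℂ} (hc : c ≠ 0) (g : SL2) :
    (∃ t : ℂ, t ≠ 0 ∧ act N g (C c * X ^ m) = t • (C c * X ^ m)) ↔
      ((g • finPt 0 = finPt 0 ∨ m = 0) ∧ (g • inftyPt = inftyPt ∨ m = N)) ∨
        (g • finPt 0 = inftyPt ∧ g • inftyPt = finPt 0 ∧ 2 * m = N) := by
  rw [smul_inftyPt_eq_inftyPt, smul_inftyPt_eq_finPt, smul_finPt_eq_inftyPt, smul_finPt_eq_finPt]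
  simp only [mul_zero, zero_add, zero_mul]
  rw [and_left_comm, ← linear_factors_eq_X_pow_iff hm (det_expand g)]
  refine exists_congr fun t => and_congr_right fun _ => ?_
  rw [← smul_eq_C_mul, map_smul, act_X_pow hm, smul_comm, smul_eq_C_mul t]
  exact (smul_right_injective _ hc).eq_iff

/-- Fixing `0` and `∞` makes the matrix diagonal; a third fixed point makes it scalar. -/
theorem smul_eq_of_fixes_three {k : SL2} {t : CP1} (h0 : finPt 0 ≠ t) (hi : inftyPt ≠ t)
    (h1 : k • finPt 0 = finPt 0) (h2 : k • inftyPt = inftyPt) (h3 : k • t = t) (y : CP1) :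
    k • y = y := by
  obtain ⟨z, rfl⟩ | rfl := eq_finPt_or_eq_inftyPt t
  swap
  · exact absurd rfl hi
  have hz : z ≠ 0 := by
    rintro rfl
    exact h0 rfl
  rw [smul_finPt_eq_finPt] at h1 h3
  rw [smul_inftyPt_eq_inftyPt] at h2
  simp only [mul_zero, zero_add, zero_mul] at h1
  rw [h1, h2, zero_mul, zero_add, add_zero, mul_comm] at h3
  have h4 := mul_left_cancel₀ hz h3
  obtain ⟨w, rfl⟩ | rfl := eq_finPt_or_eq_inftyPt y
  · rw [smul_finPt_eq_finPt, h1, h2, h4]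
    ring
  · rwa [smul_inftyPt_eq_inftyPt]

/-- An element of `PSL₂` fixing three points is trivial. -/
theorem eq_one_of_fixes_three {x : PSL2} {r s t : CP1} (hrs : r ≠ s) (hrt : r ≠ t) (hst : s ≠ t)
    (hr : x • r = r) (hs : x • s = s) (ht : x • t = t) : x = 1 := by
  obtain ⟨h, rfl⟩ := QuotientGroup.mk_surjective x
  rw [Matrix.ProjectiveSpecialLinearGroup.smul_proj_mk] at hr hs ht
  obtain ⟨g, rfl, rfl⟩ := exists_smul_eq_pair hrs
  obtain ⟨t, rfl⟩ := MulAction.surjective g t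
  obtain ⟨k, rfl⟩ : ∃ k : SL2, h = g * k * g⁻¹ := ⟨g⁻¹ * h * g, by group⟩
  have hconj : ∀ y : CP1, (g * k * g⁻¹) • g • y = g • k • y := fun y => by
    rw [mul_smul, mul_smul, inv_smul_smul]
  rw [hconj] at hr hs ht
  have h1 := MulAction.injective g hr
  have h2 := MulAction.injective g hs
  have h3 := MulAction.injective g ht
  have hkone := smul_eq_of_fixes_three (fun h => hrt (by rw [h])) (fun h => hst (by rw [h]))
    h1 h2 h3
  refine eq_of_smul_eq_smul (α := CP1) fun y => ?_
  obtain ⟨y, rfl⟩ := MulAction.surjective g y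
  rw [Matrix.ProjectiveSpecialLinearGroup.smul_proj_mk, one_smul, hconj, hkone]

/-- The group fixing two points is infinite. -/
theorem infinite_fixes_two {r s : CP1} (hrs : r ≠ s) {S : Set PSL2}
    (hS : ∀ x : PSL2, x • r = r → x • s = s → x ∈ S) : S.Infinite := by
  obtain ⟨g, rfl, rfl⟩ := exists_smul_eq_pair hrs
  have ht : ∀ n : ℕ, (n : ℂ) + 1 ≠ 0 := fun n => Nat.cast_add_one_ne_zero n
  -- These act as `z ↦ (n + 1) ^ 2 z`, so the images of `1` tell them apart even in `PSL₂`.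
  let d : ℕ → SL2 := fun n => ⟨!![(n : ℂ) + 1, 0; 0, ((n : ℂ) + 1)⁻¹], by
    rw [Matrix.det_fin_two_of, mul_inv_cancel₀ (ht n), mul_zero, sub_zero]⟩
  let f : ℕ → PSL2 := fun n => ((g * d n * g⁻¹ : SL2) : PSL2)
  have hf : ∀ n (y : CP1), f n • g • y = g • d n • y := fun n y => by
    rw [Matrix.ProjectiveSpecialLinearGroup.smul_proj_mk, mul_smul, mul_smul, inv_smul_smul]
  refine Set.infinite_of_injective_forall_mem (f := f) ?_ fun n => hS _ ?_ ?_
  · intro n n' hnn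
    have h1 : ∀ n, d n • finPt 1 = finPt (((n : ℂ) + 1) ^ 2) := by
      intro n
      rw [smul_finPt_eq_finPt]
      have := ht n
      simp [d]
      field_simp
    have h2 := congrArg (fun x : PSL2 => x • g • finPt 1) hnn
    simp only [hf, h1] at h2
    have h3 := finPt_injective (MulAction.injective g h2)
    have h4 : (n + 1) ^ 2 = (n' + 1) ^ 2 := by exact_mod_cast h3
    have h5 := Nat.pow_left_injective (n := 2) (by norm_num) h4
    omega
  · rw [hf]
    congr 1
    rw [smul_finPt_eq_finPt]
    simp [d]
  · rw [hf]
    congr 1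
    rw [smul_inftyPt_eq_inftyPt]
    simp [d]

theorem infinite_of_isInfiniteType {S : Set PSL2} (hS : IsInfiniteType S) : S.Infinite := by
  rcases hS with ⟨r, rfl⟩ | ⟨r, s, hrs, rfl | rfl⟩
  · obtain ⟨s, hrs⟩ := exists_ne_point r
    exact infinite_fixes_two hrs fun x hr _ => hr
  · exact infinite_fixes_two hrs fun x hr hs => ⟨hr, hs⟩
  · refine infinite_fixes_two hrs fun x hr hs => ?_
    rw [SetLike.mem_coe, MulAction.mem_stabilizer_iff, Set.smul_set_insert, Set.smul_set_singleton, hr, hs]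

theorem projStab_eq {N : ℕ} {Q : ℂ[X]} (hQ : Q ≠ 0) (hQN : Q.natDegree ≤ N) {S : Set PSL2}
    (hS : ∀ h : SL2, (∃ t : ℂ, t ≠ 0 ∧ act N h Q = t • Q) ↔ (h : PSL2) ∈ S) :
    projStab N Q = S := by
  ext x
  obtain ⟨h, rfl⟩ := QuotientGroup.mk_surjective x
  constructor
  · rintro ⟨h', hh', he⟩
    rw [← he]
    exact (hS h').mp ((map_span_eq_iff hQ hQN h').mp hh')
  · intro hx
    exact ⟨h, (map_span_eq_iff hQ hQN h).mpr ((hS h).mpr hx), rfl⟩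

/-- A form with at least three distinct roots has a finite symmetry group. -/
theorem rootCount_le_two_of_infinite {N : ℕ} {Q : ℂ[X]} (hQ : Q ≠ 0) (hQN : Q.natDegree ≤ N)
    (h : (projStab N Q).Infinite) : rootCount N Q ≤ 2 := by
  by_contra! h3
  rw [← ncard_projRoots hQ, Set.two_lt_ncard (finite_projRoots hQ)] at h3
  obtain ⟨r, hr, s, hs, t, ht, hrs, hrt, hst⟩ := h3
  refine h ?_
  have hmem : ∀ x ∈ projStab N Q, ∀ y ∈ projRoots N Q, x • y ∈ projRoots N Q := by
    rintro _ ⟨g, hg, rfl⟩ y hy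
    obtain ⟨c, hc, he⟩ := (map_span_eq_iff hQ hQN g).mp hg
    change g • y ∈ projRoots N Q
    rw [← mem_projRoots_act hQN, he, projRoots_smul hc]
    exact hy
  have hfin := finite_projRoots (N := N) hQ
  -- A symmetry is determined by the images of three roots, which lie in a finite set.
  refine Set.Finite.of_finite_image (f := fun x : PSL2 => (x • r, x • s, x • t))
    ((hfin.prod (hfin.prod hfin)).subset ?_) ?_
  · rintro _ ⟨x, hx, rfl⟩
    exact ⟨hmem x hx r hr, hmem x hx s hs, hmem x hx t ht⟩
  · intro x _ y _ hxy
    simp only [Prod.mk.injEq] at hxy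
    have := eq_one_of_fixes_three (x := y⁻¹ * x) hrs hrt hst
      (by rw [mul_smul, hxy.1, inv_smul_smul]) (by rw [mul_smul, hxy.2.1, inv_smul_smul])
      (by rw [mul_smul, hxy.2.2, inv_smul_smul])
    exact (inv_mul_eq_one.mp this).symm

/-- The symmetry group of a form equivalent to a monomial. -/
theorem isInfiniteType_projStab {N m : ℕ} (hN : N ≠ 0) {Q : ℂ[X]} (hQ : Q ≠ 0)
    (hQN : Q.natDegree ≤ N) (hm : m ≤ N) {g : SL2} {c : ℂ} (hc : c ≠ 0)
    (hg : act N g Q = C c * X ^ m) : IsInfiniteType (projStab N Q) := by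
  -- Conjugation by `g` carries the symmetries of `Q` to those of the monomial.
  have hstab : ∀ h : SL2, (∃ t : ℂ, t ≠ 0 ∧ act N h Q = t • Q) ↔
      ((h • g • finPt 0 = g • finPt 0 ∨ m = 0) ∧ (h • g • inftyPt = g • inftyPt ∨ m = N)) ∨
        (h • g • finPt 0 = g • inftyPt ∧ h • g • inftyPt = g • finPt 0 ∧ 2 * m = N) := by
    intro h
    have h1 := act_monomial_proportional_iff hm hc (g⁻¹ * h * g)
    simp only [mul_smul, inv_smul_eq_iff] at h1
    rw [← h1, ← hg]
    refine exists_congr fun t => and_congr_right fun _ => ?_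
    rw [act_act, mul_assoc, mul_inv_cancel_left, ← act_act, ← map_smul]
    constructor
    · intro he
      rw [he]
    · intro he
      have := congrArg (act N g⁻¹) he
      rwa [act_inv_act (natDegree_act_le _ _ _), act_inv_act ((natDegree_smul_le _ _).trans hQN)]
        at this
  have hne : g • finPt 0 ≠ g • inftyPt := fun h =>
    finPt_ne_inftyPt 0 (MulAction.injective g h)
  -- For `m = 0` or `m = N` there is one root, and its stabilizer is the whole group. Otherwise
  -- there are two, and they can be swapped only when `2 m = N`.
  rcases Nat.eq_zero_or_pos m with rfl | hm0
  · refine Or.inl ⟨g • inftyPt, projStab_eq hQ hQN fun h => ?_⟩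
    rw [hstab, SetLike.mem_coe, MulAction.mem_stabilizer_iff,
      Matrix.ProjectiveSpecialLinearGroup.smul_proj_mk]
    simp [hN.symm]
  rcases hm.eq_or_lt with rfl | hmN
  · refine Or.inl ⟨g • finPt 0, projStab_eq hQ hQN fun h => ?_⟩
    rw [hstab, SetLike.mem_coe, MulAction.mem_stabilizer_iff,
      Matrix.ProjectiveSpecialLinearGroup.smul_proj_mk]
    simp [hN]
  refine Or.inr ⟨g • finPt 0, g • inftyPt, hne, ?_⟩
  by_cases h2 : 2 * m = N
  · refine Or.inr (projStab_eq hQ hQN fun h => ?_)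
    rw [hstab, SetLike.mem_coe, MulAction.mem_stabilizer_iff, Set.smul_set_insert, Set.smul_set_singleton,
      Set.pair_eq_pair_iff]
    simp [Matrix.ProjectiveSpecialLinearGroup.smul_proj_mk, hm0.ne', hmN.ne, h2]
  · refine Or.inl (projStab_eq hQ hQN fun h => ?_)
    rw [hstab, SetLike.mem_coe, Subgroup.mem_inf, MulAction.mem_stabilizer_iff,
      MulAction.mem_stabilizer_iff]
    simp [Matrix.ProjectiveSpecialLinearGroup.smul_proj_mk, hm0.ne', hmN.ne, h2]

/-! ### Transfer between subspaces and Wronskians, and the equivalences -/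

theorem linear_ne_zero {a b : ℂ} (h : a ≠ 0 ∨ b ≠ 0) : C a * X + C b ≠ (0 : ℂ[X]) := by
  intro h0
  have h1 := congrArg (fun q => coeff q 0) h0
  have h2 := congrArg (fun q => coeff q 1) h0
  simp at h1 h2
  tauto

theorem cov_of_act_eq_X_pow {N m : ℕ} (hN : N ≠ 0) {Q : ℂ[X]} (hQN : Q.natDegree ≤ N)
    (hm : m ≤ N) {g : SL2} {c : ℂ} (hc : c ≠ 0) (hg : act N g Q = C c * X ^ m) :
    covH N Q = 0 ∨ (covH N Q ≠ 0 ∧ ∃ t : ℂ, covJ2 N Q = RatFunc.C t) := by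
  obtain ⟨l, rfl⟩ := Nat.exists_eq_add_of_le hm
  have hQ := act_inv_act hQN g
  rw [hg, ← smul_eq_C_mul, map_smul, act_X_pow hm, smul_eq_C_mul, Nat.add_sub_cancel_left] at hQ
  have hdet := det_expand g⁻¹
  refine cov_of_linear_factors hN (linear_ne_zero ?_) (den_ne_zero g⁻¹) hc hQ.symm
  by_contra! h0
  rw [h0.1, h0.2] at hdet
  simp at hdet

theorem natDegree_le_of_mem_degreeLE {n : ℕ} {U : Submodule ℂ ℂ[X]} (hU : U ≤ degreeLE ℂ n)
    {q : ℂ[X]} (hq : q ∈ U) : q.natDegree ≤ n :=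
  natDegree_le_iff_degree_le.mpr (mem_degreeLE.mp (hU hq))

theorem map_span_range_act {k : ℕ} (n : ℕ) (g : SL2) (p : Fin k → ℂ[X]) :
    (Submodule.span ℂ (Set.range p)).map (act n g) =
      Submodule.span ℂ (Set.range fun i => act n g (p i)) := by
  rw [Submodule.map_span, ← Set.range_comp]
  rfl

theorem linearIndependent_act {k n : ℕ} {p : Fin k → ℂ[X]} (hp : LinearIndependent ℂ p)
    (hU : Submodule.span ℂ (Set.range p) ≤ degreeLE ℂ n) (g : SL2) :
    LinearIndependent ℂ fun i => act n g (p i) := by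
  refine hp.map (f := act n g) (Submodule.disjoint_def.mpr fun x hx hker => ?_)
  by_contra hx0
  exact act_ne_zero (natDegree_le_of_mem_degreeLE hU hx) hx0 g hker

/-- A subspace is equivalent to a monomial subspace if and only if its Wronskian is equivalent to
a monomial. -/
theorem exists_projEquiv_monomial_iff {k n : ℕ} (hkn : k ≤ n) {p : Fin k → ℂ[X]}
    (hp : LinearIndependent ℂ p) (hU : Submodule.span ℂ (Set.range p) ≤ degreeLE ℂ n) :
    (∃ V, IsMonomialSubspace k n V ∧ ProjEquiv n (Submodule.span ℂ (Set.range p)) V) ↔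
      ∃ (g : SL2) (c : ℂ) (m : ℕ), c ≠ 0 ∧ m ≤ k * (n + 1 - k) ∧
        act (k * (n + 1 - k)) g (wronskian p) = C c * X ^ m := by
  have hpn : ∀ i, (p i).natDegree ≤ n := fun i =>
    natDegree_le_of_mem_degreeLE hU (Submodule.subset_span ⟨i, rfl⟩)
  constructor
  · rintro ⟨_, ⟨ν, _, _, hV⟩, g, rfl⟩
    rw [map_span_range_act] at hV
    obtain ⟨d, hd⟩ := exists_wronskian_eq (p := fun i => (X : ℂ[X]) ^ ν i)
      -- The transformed basis lies in the span of the monomials, so its Wronskian is a multiple of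
      -- a monomial.
      (q := fun i => act n g (p i)) fun i => hV ▸ Submodule.subset_span ⟨i, rfl⟩
    obtain ⟨c, m, hc⟩ := exists_wronskian_X_pow ν
    rw [hc, ← mul_assoc, ← C_mul, wronskian_act hkn hpn] at hd
    have h0 := act_ne_zero (natDegree_wronskian_le hkn hpn) (wronskian_ne_zero hp hpn) g
    have hdc : d * c ≠ 0 := by
      intro h
      rw [hd, h, C_0, zero_mul] at h0
      exact h0 rfl
    refine ⟨g, d * c, m, hdc, ?_, hd⟩
    have := natDegree_act_le (k * (n + 1 - k)) g (wronskian p)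
    rwa [hd, natDegree_C_mul_X_pow _ _ hdc] at this
  · rintro ⟨g, c, m, -, -, h⟩
    refine ⟨_, ?_, g, rfl⟩
    rw [← wronskian_act hkn hpn] at h
    rw [map_span_range_act]
    exact isMonomialSubspace_of_wronskian (linearIndependent_act hp hU g)
      (fun i => natDegree_act_le n g (p i)) h

end PolySubspace

open PolySubspace in
theorem theorem5p5 (k n N : ℕ) (hk : 1 ≤ k) (hkn : k ≤ n) (hN : N = k * (n + 1 - k))
    (U : Submodule ℂ ℂ[X]) (hU : U ∈ grassmannian k n)
    (p : Fin k → ℂ[X]) (hp : LinearIndependent ℂ p) (hpU : Submodule.span ℂ (Set.range p) = U)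
    (Q : ℂ[X]) (hQ : Q = PolySubspace.wronskian p) :
    [ ∃ V : Submodule ℂ ℂ[X], IsMonomialSubspace k n V ∧ ProjEquiv n U V,
      (projRoots N Q).ncard = 1 ∨ (projRoots N Q).ncard = 2,
      covH N Q = 0 ∨ (covH N Q ≠ 0 ∧ ∃ c : ℂ, covJ2 N Q = RatFunc.C c),
      (projStab N Q).Infinite,
      IsInfiniteType (projStab N Q) ].TFAE := by
  subst hpU hQ hN
  have hpn : ∀ i, (p i).natDegree ≤ n := fun i =>
    natDegree_le_of_mem_degreeLE hU.1 (Submodule.subset_span ⟨i, rfl⟩)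
  have hQ := wronskian_ne_zero hp hpn
  have hQN := natDegree_wronskian_le hkn hpn
  have hN : k * (n + 1 - k) ≠ 0 := Nat.mul_ne_zero (by omega) (by omega)
  -- The first condition now says that `Q` is equivalent to a monomial; the others are compared with
  -- this form.
  rw [exists_projEquiv_monomial_iff hkn hp hU.1, ncard_projRoots hQ]
  have hpos := rootCount_pos hN hQ hQN
  tfae_have 2 → 1 := fun h => exists_act_eq_X_pow hQ hQN (by rwa [ncard_projRoots hQ])
  tfae_have 1 → 3 := fun ⟨_, _, _, hc, hm, h⟩ => cov_of_act_eq_X_pow hN hQN hm hc h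
  tfae_have 3 → 2 := fun h => by
    have := rootCount_le_two_of_cov hN hQ hQN h
    omega
  tfae_have 1 → 5 := fun ⟨_, _, _, hc, hm, h⟩ => isInfiniteType_projStab hN hQ hQN hm hc h
  tfae_have 5 → 4 := infinite_of_isInfiniteType
  tfae_have 4 → 2 := fun h => by
    have := rootCount_le_two_of_infinite hQ hQN h
    omega
  tfae_finish
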